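/- Let $T>0$, $d\ge 0$. Let $\gamma\mathbb R^d$ be the compactification of $\mathbb R^d$ by infinite directions, i.e. the closed unit ball, in which $\mathbb R^d$ is embedded by $x\mapsto x/(1+|x|)$ and $e\in S^{d-1}$ is the infinite point in direction $e$. For $a\in\mathbb R^d$, $b>0$ let $a/b\in\mathbb R^d\subset\gamma\mathbb R^d$, and for $a\ne0$ let $a/0:=\lim_{b\searrow0}a/b$ be the infinite point in direction $a$. Let $(u_j)_{j\in\mathbb N}$ be a bounded sequence in $L^1([0,T];\mathbb R^d)$ and let $(\tilde v_j,\tilde u_j)\in L^\infty([0,S_j];[0,\infty)\times\mathbb R^d)$ be the corresponding normalized vertical relaxations: with $\tilde t_j(s)=\int_0^s\tilde v_j(r)\,dr$ one has $\tilde t_j(S_j)=T$ and, for almost every $s\in[0,S_j]$, $\tilde u_j(s)=\tilde v_j(s)\,u_j(\tilde t_j(s))$ and $\max(\tilde v_j(s),|\tilde u_j(s)|)=1$. Let $S_j\to S$ and suppose that the pairs $(\tilde u_j,\tilde v_j)$, extended by $(0,0)$ beyond $S_j$, generate on $[0,S]$ the Young measure $(\nu_s)_{s\in[0,S]}$, a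 measurable family of probability measures on $\mathbb R^d\times\mathbb R\ni(a,b)$; that is, for every $\varphi\in C_c(\mathbb R^d\times\mathbb R)$ the functions $\varphi(\tilde u_j,\tilde v_j)$ converge to $s\mapsto\int\varphi\,d\nu_s$ weakly-$*$ in $L^\infty([0,S])$. Put $$\tilde t(s):=\int_0^s\!\int b\,d\nu_r(a,b)\,dr,\qquad \rho(s):=\int(|a|+|b|)\,d\nu_s(a,b)\qquad(s\in[0,S]).$$ Then $\tilde t:[0,S]\to[0,T]$ is nondecreasing and onto, and for every $t\in[0,T]$ the fibre $\tilde t^{-1}(t)$ is a point or a nondegenerate closed interval. Let $\sigma$ be the pushforward under $\tilde t$ of the measure $\rho(s)\,ds$ on $[0,S]$, and let $\mu_t$ be the measure on $\gamma\mathbb R^d$ obtained by transporting $\frac1{\rho(s)}(b+|a|)\,\nu_s$ by $(a,b)\mapsto a/b$ if $\tilde t^{-1}(t)=\{s\}$, and by averaging these transported measures uniformly over $s\in\tilde t^{-1}(t)$ if $\tilde t^{-1}(t)$ is an interval. That is, for every $g\in C([0,T])$, $$\int_{[0,T]}g\,d\sigma=\int_0^S\rho(s)\,g(\tilde t(s))\,ds,$$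 and for $\sigma$-almost every $t$ and every $w\in C(\gamma\mathbb R^d)$ $$\int_{\gamma\mathbb R^d}w\,d\mu_t=\begin{cases}\displaystyle\int\tfrac1{\rho(s)}\,w(a/b)\,(b+|a|)\,d\nu_s(a,b)&\text{if }\tilde t^{-1}(t)=\{s\},\\[2ex]\displaystyle\frac1{|\tilde t^{-1}(t)|}\int_{\tilde t^{-1}(t)}\frac1{\rho(s)}\int w(a/b)\,(b+|a|)\,d\nu_s(a,b)\,ds&\text{if }\tilde t^{-1}(t)\text{ is an interval.}\end{cases}$$ Moreover $(\sigma,\mu_t)$ is a DiPerna–Majda measure ($\sigma$ is a finite positive measure on $[0,T]$, and $\mu_t$ is a $\sigma$-measurable family of measures on $\gamma\mathbb R^d$, of unit mass for $\sigma$-almost every $t$), and it is generated by $(u_j)$: for all $g\in C([0,T])$ and $w\in C(\gamma\mathbb R^d)$, $$\int_0^Tg(t)\,w(u_j(t))\,(1+|u_j(t)|)\,dt\;\longrightarrow\;\int_{[0,T]}g(t)\int_{\gamma\mathbb R^d}w(y)\,d\mu_t(y)\,d\sigma(t).$$ -/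

import Mathlib

open MeasureTheory Filter Topology Set

noncomputable section

namespace SpaceTime

/-- `ℝ^d` with its Euclidean norm. -/
abbrev Vec (d : ℕ) : Type := EuclideanSpace ℝ (Fin d)

/-- The compactification `γℝ^d` of `ℝ^d` by infinite directions, realised as the closed unit
ball: the open ball is the copy of `ℝ^d` (see `toComp`), and the unit sphere is the set of
infinite directions (see `infDir`). -/
abbrev DirComp (d : ℕ) : Type := Metric.closedBall (0 : Vec d) 1

/-- The inclusion `ℝ^d → γℝ^d`, `x ↦ x / (1 + |x|)`. -/
def toComp {d : ℕ} (x : Vec d) : DirComp d :=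
  ⟨(1 + ‖x‖)⁻¹ • x, by
    have h : 0 < 1 + ‖x‖ := by positivity
    rw [mem_closedBall_zero_iff, norm_smul, norm_inv, Real.norm_of_nonneg h.le,
      inv_mul_le_iff₀ h]
    linarith⟩

/-- The infinite point of `γℝ^d` in the direction of `a ≠ 0`. -/
def infDir {d : ℕ} (a : Vec d) : DirComp d :=
  ⟨‖a‖⁻¹ • a, by
    rw [mem_closedBall_zero_iff, norm_smul, norm_inv, norm_norm]
    exact inv_mul_le_one⟩

/-- The point `a / b` of `γℝ^d`, where `a / 0` is the infinite point in the direction of `a`.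
(For `(a, b) = (0, 0)` or `b < 0` the value is irrelevant.) -/
def ratio {d : ℕ} (z : Vec d × ℝ) : DirComp d :=
  if 0 < z.2 then toComp (z.2⁻¹ • z.1) else infDir z.1

/-- `a / 0` is the limit of `a / b` as `b ↘ 0`. -/
theorem tendsto_ratio {d : ℕ} {a : Vec d} (ha : a ≠ 0) :
    Tendsto (fun b : ℝ => ratio (a, b)) (𝓝[>] 0) (𝓝 (ratio (a, 0))) := by
  have hn : 0 < ‖a‖ := norm_pos_iff.mpr ha
  rw [tendsto_subtype_rng]
  have h0 : ((ratio (a, (0 : ℝ)) : DirComp d) : Vec d) = (0 + ‖a‖)⁻¹ • a := by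
    simp [ratio, infDir]
  rw [h0]
  have h1 : Tendsto (fun b : ℝ => (b + ‖a‖)⁻¹ • a) (𝓝[>] 0) (𝓝 ((0 + ‖a‖)⁻¹ • a)) := by
    apply Tendsto.mono_left _ nhdsWithin_le_nhds
    have hc : ContinuousAt (fun b : ℝ => (b + ‖a‖)⁻¹ • a) 0 :=
      ((continuousAt_id.add continuousAt_const).inv₀ (by simpa using ha)).smul continuousAt_const
    exact hc
  refine h1.congr' ?_
  filter_upwards [self_mem_nhdsWithin] with b hb
  have hb' : (0 : ℝ) < b := hb
  simp only [ratio, if_pos hb', toComp, norm_smul, norm_inv, Real.norm_of_nonneg hb'.le,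
    smul_smul]
  congr 1
  field_simp

/-- The time `t̃(s) = ∫₀ˢ v(r) dr` which runs with speed `v`, i.e. the solution of
`t̃' = v`, `t̃(0) = 0`. -/
def timeOf (v : ℝ → ℝ) (s : ℝ) : ℝ := ∫ r in (0 : ℝ)..s, v r

/-- `(v, w)` on `[0, S]` is the normalized vertical relaxation of the control `u` on `[0, T]`:
with `t̃ = timeOf v` one has `t̃(S) = T`, the relaxed control is associated with `u`, that is
`w(s) = v(s) u(t̃(s))`, and it is normalized, that is `max (v, |w|) = 1`. -/
structure IsNormalizedRelaxation {d : ℕ} (T : ℝ) (u : ℝ → Vec d)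
    (S : ℝ) (v : ℝ → ℝ) (w : ℝ → Vec d) : Prop where
  length_nonneg : 0 ≤ S
  memLp_v : MemLp v ⊤ (volume.restrict (Icc 0 S))
  memLp_w : MemLp w ⊤ (volume.restrict (Icc 0 S))
  nonneg : ∀ᵐ s ∂volume.restrict (Icc 0 S), 0 ≤ v s
  time_end : timeOf v S = T
  associated : ∀ᵐ s ∂volume.restrict (Icc 0 S), w s = v s • u (timeOf v s)
  normalized : ∀ᵐ s ∂volume.restrict (Icc 0 S), max (v s) ‖w s‖ = 1

/-- The pair `(w, v)` on `[0, S]`, extended by `(0, 0)`. -/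
def extendPair {d : ℕ} (S : ℝ) (v : ℝ → ℝ) (w : ℝ → Vec d) : ℝ → Vec d × ℝ :=
  (Icc 0 S).indicator fun s => (w s, v s)

/-- A measurable family `ν_s`, `s ∈ [0, S]`, of probability measures (both up to null sets). -/
structure IsYoungMeasure {X : Type*} [MeasurableSpace X] (S : ℝ) (ν : ℝ → Measure X) :
    Prop where
  aemeasurable : AEMeasurable ν (volume.restrict (Icc 0 S))
  isProbabilityMeasure : ∀ᵐ s ∂volume.restrict (Icc 0 S), IsProbabilityMeasure (ν s)

/-- The sequence `z` of functions generates the Young measure `ν` on `[0, S]`: for every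
continuous compactly supported `φ`, the functions `φ ∘ z_j` converge weakly-* in
`L^∞([0, S])` to `s ↦ ∫ φ dν_s`. -/
structure GeneratesYoung {X : Type*} [TopologicalSpace X] [MeasurableSpace X] (S : ℝ)
    (z : ℕ → ℝ → X) (ν : ℝ → Measure X) : Prop where
  isYoungMeasure : IsYoungMeasure S ν
  tendsto : ∀ φ : X → ℝ, Continuous φ → HasCompactSupport φ →
    ∀ g : ℝ → ℝ, IntegrableOn g (Icc 0 S) →
      Tendsto (fun j => ∫ s in Icc 0 S, g s * φ (z j s)) atTop
        (𝓝 (∫ s in Icc 0 S, g s * ∫ x, φ x ∂ν s))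

/-- A DiPerna-Majda measure on `[0, T]`: a finite positive Borel measure `σ` on `[0, T]` and a
`σ`-measurable family of probability measures on `γℝ^d`. -/
structure IsDiPernaMajda {d : ℕ} (T : ℝ) (σ : Measure ℝ) (μ : ℝ → Measure (DirComp d)) :
    Prop where
  isFiniteMeasure : IsFiniteMeasure σ
  concentrated : σ (Icc 0 T)ᶜ = 0
  aemeasurable : AEMeasurable μ σ
  isProbabilityMeasure : ∀ᵐ t ∂σ, IsProbabilityMeasure (μ t)

/-- The sequence `u` in `L¹([0, T]; ℝ^d)` generates the DiPerna-Majda measure `(σ, μ)`. -/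
structure GeneratesDiPernaMajda {d : ℕ} (T : ℝ) (u : ℕ → ℝ → Vec d) (σ : Measure ℝ)
    (μ : ℝ → Measure (DirComp d)) : Prop where
  isDiPernaMajda : IsDiPernaMajda T σ μ
  tendsto : ∀ g : ℝ → ℝ, ContinuousOn g (Icc 0 T) → ∀ w : C(DirComp d, ℝ),
    Tendsto (fun j => ∫ t in Icc 0 T, g t * w (toComp (u j t)) * (1 + ‖u j t‖)) atTop
      (𝓝 (∫ t in Icc 0 T, g t * ∫ y, w y ∂μ t ∂σ))

/-- The time belonging to a Young measure on pairs `(a, b)`: `t̃(s) = ∫₀ˢ ∫ b dν_r(a, b) dr`. -/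
def youngTime {d : ℕ} (ν : ℝ → Measure (Vec d × ℝ)) : ℝ → ℝ :=
  timeOf fun r => ∫ z, z.2 ∂ν r

/-- `ρ(s) = ∫ (|a| + |b|) dν_s(a, b)`. -/
def rho {d : ℕ} (ν : ℝ → Measure (Vec d × ℝ)) (s : ℝ) : ℝ := ∫ z, (‖z.1‖ + |z.2|) ∂ν s

/-- The fibre `t̃⁻¹(t) ⊆ [0, S]`. -/
def fibre {d : ℕ} (S : ℝ) (ν : ℝ → Measure (Vec d × ℝ)) (t : ℝ) : Set ℝ :=
  {s ∈ Icc 0 S | youngTime ν s = t}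

/-- `σ`, the pushforward under `t̃` of the measure `ρ(s) ds` on `[0, S]`. -/
def dpmSigma {d : ℕ} (S : ℝ) (ν : ℝ → Measure (Vec d × ℝ)) : Measure ℝ :=
  ((volume.restrict (Icc 0 S)).withDensity fun s => ENNReal.ofReal (rho ν s)).map
    (youngTime ν)

/-- The measure `ρ(s)⁻¹ (b + |a|) dν_s(a, b)`, transported to `γℝ^d` by `(a, b) ↦ a / b`. -/
def transported {d : ℕ} (ν : ℝ → Measure (Vec d × ℝ)) (s : ℝ) : Measure (DirComp d) :=
  ((ν s).withDensity fun z => ENNReal.ofReal ((rho ν s)⁻¹ * (z.2 + ‖z.1‖))).map ratio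

open scoped Classical in
/-- `μ_t`: the transported measure at `s` if the fibre over `t` is the point `s`, and the average
of the transported measures over the fibre if the fibre is a nondegenerate interval. -/
def dpmMu {d : ℕ} (S : ℝ) (ν : ℝ → Measure (Vec d × ℝ)) (t : ℝ) : Measure (DirComp d) :=
  if (fibre S ν t).Subsingleton then transported ν (sInf (fibre S ν t))
  else (volume (fibre S ν t))⁻¹ • (volume.restrict (fibre S ν t)).bind (transported ν)

end SpaceTime

end

open SpaceTime

/-!
The relaxed pairs `(w_j, v_j)` take values in the half-sphere `{(a, b) | max (|a|, |b|) = 1, b ≥ 0}`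
(`halfSphere`) except on a set of vanishing length, so almost every `ν_s` is a probability measure
on it (`GeneratesYoung.ae_isHalfSphereMeasure`). Hence the convergence to `ν` may be tested with any
continuous function. Testing with `b` shows that the times `t̃_j` converge pointwise to `t̃`
(`GeneratesYoung.tendsto_timeOf`); testing with the positively homogeneous function
`(a, b) ↦ f (a / b) (b + |a|)`, which is continuous because `a / b` is the point `a / (b + |a|)` of
the closed ball (`coe_ratio`, `continuous_homogExt`), gives the limit of the functionals of `u_j`.
Indeed the substitution `t = t̃_j(s)` (`map_timeOf`, `integral_comp_timeOf`) turns
`∫ g f(u_j) (1 + |u_j|) dt` into `∫ g(t̃_j) f(w_j / v_j) (v_j + |w_j|) ds`, whose limit is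
`∫ g(t̃(s)) ∫ f(a / b) (b + |a|) dν_s ds` (`GeneratesYoung.tendsto_integral`).

It remains to recognise this limit as the integral of `g ⊗ f` against `(σ, μ)` (`integral_dpm`).
Only countably many times have a nondegenerate fibre. Over point fibres the two integrands on
`[0, S]` agree. On a nondegenerate fibre `t̃` is constant, so `b = 0` holds `ν_s`-almost surely and
the normalization forces `|a| = 1` and thus `ρ = 1` (`ae_rho_eq_one_of_fibre_eq_Icc`); with the
constant weight `ρ` the uniform average in the definition of `μ_t` does not change the integral
over the fibre.

Measurability with respect to `σ`, which may charge Lebesgue null sets, rests on the monotone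
function `t ↦ inf t̃⁻¹(t)`, a left inverse of `t̃` on point fibres (`ae_dpmSigma_of_ae`,
`aemeasurable_dpmMu`).
-/

namespace SpaceTime

/-! ### Monotone changes of time -/

theorem exists_preimage_eq_Icc {τ : ℝ → ℝ} {a b t : ℝ} (hm : MonotoneOn τ (Icc a b))
    (hc : ContinuousOn τ (Icc a b)) (h : ∃ s ∈ Icc a b, τ s = t) :
    ∃ c e, c ≤ e ∧ {s ∈ Icc a b | τ s = t} = Icc c e := by
  obtain ⟨s₀, hs₀, hτ₀⟩ := h
  set K : Set ℝ := {s ∈ Icc a b | τ s = t} with hK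
  have hne : K.Nonempty := ⟨s₀, hs₀, hτ₀⟩
  have hcl : IsClosed K := hc.preimage_isClosed_of_isClosed isClosed_Icc isClosed_singleton
  have hco : IsCompact K := isCompact_Icc.of_isClosed_subset hcl fun s hs => hs.1
  have hord : K.OrdConnected := by
    refine ⟨fun x hx y hy z hz => ?_⟩
    have hz' : z ∈ Icc a b := ⟨hx.1.1.trans hz.1, hz.2.trans hy.1.2⟩
    exact ⟨hz', le_antisymm ((hm hz' hy.1 hz.2).trans hy.2.le) (hx.2.ge.trans (hm hx.1 hz' hz.1))⟩
  have heq := eq_Icc_of_connected_compact ⟨hne, hord.isPreconnected⟩ hco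
  refine ⟨sInf K, sSup K, ?_, heq⟩
  have : s₀ ∈ Icc (sInf K) (sSup K) := heq ▸ (⟨hs₀, hτ₀⟩ : s₀ ∈ K)
  exact this.1.trans this.2

@[simp]
theorem timeOf_zero (v : ℝ → ℝ) : timeOf v 0 = 0 := by simp [timeOf]

theorem timeOf_sub {v : ℝ → ℝ} {S s t : ℝ} (hv : IntegrableOn v (Icc 0 S)) (hs : s ∈ Icc 0 S)
    (ht : t ∈ Icc 0 S) : timeOf v t - timeOf v s = ∫ r in s..t, v r := by
  have hi : ∀ x ∈ Icc 0 S, IntervalIntegrable v volume 0 x := fun x hx =>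
    (intervalIntegrable_iff_integrableOn_Icc_of_le hx.1).2
      (hv.mono_set (Icc_subset_Icc_right hx.2))
  exact intervalIntegral.integral_interval_sub_left (hi t ht) (hi s hs)

theorem continuousOn_timeOf {v : ℝ → ℝ} {S : ℝ} (hS : 0 ≤ S) (hv : IntegrableOn v (Icc 0 S)) :
    ContinuousOn (timeOf v) (Icc 0 S) := by
  have := intervalIntegral.continuousOn_primitive_interval (μ := volume) (f := v) (a := 0) (b := S)
    (by rwa [uIcc_of_le hS])
  rwa [uIcc_of_le hS] at this

theorem monotoneOn_timeOf {v : ℝ → ℝ} {S : ℝ} (hv : IntegrableOn v (Icc 0 S))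
    (h0 : ∀ᵐ s ∂volume.restrict (Icc 0 S), 0 ≤ v s) : MonotoneOn (timeOf v) (Icc 0 S) := by
  intro s hs t ht hst
  rw [← sub_nonneg, timeOf_sub hv hs ht]
  exact intervalIntegral.integral_nonneg_of_ae_restrict hst
    (ae_restrict_of_ae_restrict_of_subset (Icc_subset_Icc hs.1 ht.2) h0)

theorem image_timeOf {v : ℝ → ℝ} {S : ℝ} (hS : 0 ≤ S) (hv : IntegrableOn v (Icc 0 S))
    (h0 : ∀ᵐ s ∂volume.restrict (Icc 0 S), 0 ≤ v s) :
    timeOf v '' Icc 0 S = Icc 0 (timeOf v S) := by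
  have hm := monotoneOn_timeOf hv h0
  apply Subset.antisymm
  · rintro _ ⟨s, hs, rfl⟩
    refine ⟨?_, hm hs ⟨hS, le_rfl⟩ hs.2⟩
    simpa using hm ⟨le_rfl, hS⟩ hs hs.1
  · simpa using intermediate_value_Icc hS (continuousOn_timeOf hS hv)

/-- The time change `timeOf v` transports `v(s) ds` to Lebesgue measure: the preimage of a
half-line `(-∞, x]` is an interval `[0, e]`, whose mass `∫₀ᵉ v` is the value of the time at `e`. -/
theorem map_timeOf {v : ℝ → ℝ} {S : ℝ} (hS : 0 ≤ S) (hv : IntegrableOn v (Icc 0 S))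
    (h0 : ∀ᵐ s ∂volume.restrict (Icc 0 S), 0 ≤ v s) :
    ((volume.restrict (Icc 0 S)).withDensity fun s => ENNReal.ofReal (v s)).map (timeOf v) =
      volume.restrict (Icc 0 (timeOf v S)) := by
  have hm := monotoneOn_timeOf hv h0
  have hc := continuousOn_timeOf hS hv
  have him := image_timeOf hS hv h0
  set m := (volume.restrict (Icc 0 S)).withDensity fun s => ENNReal.ofReal (v s) with hmdef
  have hac : m ≪ volume.restrict (Icc 0 S) := withDensity_absolutelyContinuous _ _
  have hmeas : AEMeasurable (timeOf v) m := (hc.aemeasurable measurableSet_Icc).mono_ac hac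
  have hfin : IsFiniteMeasure m := isFiniteMeasure_withDensity_ofReal hv.2
  have hmem : ∀ᵐ s ∂m, s ∈ Icc 0 S := hac.ae_le (ae_restrict_mem measurableSet_Icc)
  have hT : 0 ≤ timeOf v S := by simpa using hm ⟨le_rfl, hS⟩ ⟨hS, le_rfl⟩ hS
  refine Measure.ext_of_Iic _ _ fun x => ?_
  rw [Measure.map_apply_of_aemeasurable hmeas measurableSet_Iic,
    Measure.restrict_apply measurableSet_Iic]
  rcases lt_or_ge x 0 with hx | hx
  · have h1 : Iic x ∩ Icc 0 (timeOf v S) = ∅ := by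
      ext y; simp only [mem_inter_iff, mem_Iic, mem_Icc, mem_empty_iff_false, iff_false]
      rintro ⟨h, h', -⟩; linarith
    rw [h1, measure_empty, measure_eq_zero_iff_ae_notMem]
    filter_upwards [hmem] with s hs hsx
    have : timeOf v s ∈ Icc 0 (timeOf v S) := him ▸ mem_image_of_mem _ hs
    exact absurd (this.1.trans hsx) (not_le.2 hx)
  · obtain ⟨c, e, hce, hK⟩ := exists_preimage_eq_Icc (t := min x (timeOf v S)) hm hc (by
      have : min x (timeOf v S) ∈ timeOf v '' Icc 0 S := him ▸ ⟨le_min hx hT, min_le_right _ _⟩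
      exact this)
    have he : e ∈ {s ∈ Icc 0 S | timeOf v s = min x (timeOf v S)} := hK ▸ ⟨hce, le_rfl⟩
    have hset : (timeOf v ⁻¹' Iic x : Set ℝ) =ᵐ[m] Icc 0 e := by
      filter_upwards [hmem] with s hs
      refine propext ⟨fun h => ⟨hs.1, ?_⟩, fun h => ?_⟩
      · by_contra hlt
        have hlt : e < s := not_le.1 hlt
        have h1 : timeOf v s ≤ min x (timeOf v S) := le_min h (hm hs ⟨hS, le_rfl⟩ hs.2)
        have h2 : min x (timeOf v S) ≤ timeOf v s := he.2 ▸ hm he.1 hs hlt.le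
        have : s ∈ Icc c e := hK ▸ ⟨hs, le_antisymm h1 h2⟩
        exact absurd this.2 (not_le.2 hlt)
      · exact (hm hs he.1 h.2).trans (he.2.le.trans (min_le_left _ _))
    have h1 : Iic x ∩ Icc 0 (timeOf v S) = Icc 0 (min x (timeOf v S)) := by
      ext y; simp only [mem_inter_iff, mem_Iic, mem_Icc, le_min_iff]; tauto
    have hsub : Icc 0 e ⊆ Icc 0 S := Icc_subset_Icc_right he.1.2
    rw [measure_congr hset, hmdef, withDensity_apply _ measurableSet_Icc,
      Measure.restrict_restrict measurableSet_Icc, inter_eq_left.2 hsub,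
      ← ofReal_integral_eq_lintegral_ofReal (hv.mono_set hsub)
        (ae_restrict_of_ae_restrict_of_subset hsub h0), h1, Real.volume_Icc, sub_zero, ← he.2,
      timeOf, intervalIntegral.integral_of_le he.1.1, integral_Icc_eq_integral_Ioc]

theorem integral_comp_timeOf {v : ℝ → ℝ} {S : ℝ} (hS : 0 ≤ S) (hv : IntegrableOn v (Icc 0 S))
    (h0 : ∀ᵐ s ∂volume.restrict (Icc 0 S), 0 ≤ v s) {F : ℝ → ℝ}
    (hF : AEStronglyMeasurable F (volume.restrict (Icc 0 (timeOf v S)))) :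
    ∫ t in Icc 0 (timeOf v S), F t = ∫ s in Icc 0 S, v s * F (timeOf v s) := by
  have hc := continuousOn_timeOf hS hv
  rw [← map_timeOf hS hv h0] at hF ⊢
  rw [integral_map ((hc.aemeasurable measurableSet_Icc).mono_ac
      (withDensity_absolutelyContinuous _ _)) hF,
    integral_withDensity_eq_integral_toReal_smul₀ hv.1.aemeasurable.ennreal_ofReal
      (Eventually.of_forall fun _ => ENNReal.ofReal_lt_top)]
  refine integral_congr_ae ?_
  filter_upwards [h0] with s hs
  rw [ENNReal.toReal_ofReal hs, smul_eq_mul]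

/-! ### Integrals against measurable families of measures -/

theorem aemeasurable_integral_family {α X : Type*} [MeasurableSpace α] [MeasurableSpace X]
    {m : Measure α} {κ : α → Measure X} (hκ : AEMeasurable κ m) {φ : X → ℝ} (hφ : Measurable φ)
    (hint : ∀ᵐ s ∂m, Integrable φ (κ s)) : AEMeasurable (fun s => ∫ x, φ x ∂κ s) m := by
  have h : ∀ ψ : X → ℝ, Measurable ψ →
      AEMeasurable (fun s => (∫⁻ x, ENNReal.ofReal (ψ x) ∂κ s).toReal) m := fun ψ hψ =>
    ((Measure.measurable_lintegral hψ.ennreal_ofReal).comp_aemeasurable hκ).ennreal_toReal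
  refine ((h φ hφ).sub (h (fun x => -φ x) hφ.neg)).congr ?_
  filter_upwards [hint] with s hs
  exact (integral_eq_lintegral_pos_part_sub_lintegral_neg_part hs).symm

theorem measurable_withDensity_left {X : Type*} [MeasurableSpace X] {q : X → ENNReal}
    (hq : Measurable q) : Measurable fun m : Measure X => m.withDensity q := by
  refine Measure.measurable_of_measurable_coe _ fun A hA => ?_
  simp_rw [withDensity_apply _ hA, ← lintegral_indicator hA]
  exact Measure.measurable_lintegral (hq.indicator hA)

theorem aemeasurable_smul_family {α X : Type*} [MeasurableSpace α] [MeasurableSpace X]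
    {m : Measure α} {κ : α → Measure X} {c : α → ENNReal} (hκ : AEMeasurable κ m)
    (hc : AEMeasurable c m) : AEMeasurable (fun s => c s • κ s) m := by
  refine ⟨fun s => hc.mk c s • hκ.mk κ s, ?_, ?_⟩
  · refine Measure.measurable_of_measurable_coe _ fun A hA => ?_
    simp only [Measure.smul_apply, smul_eq_mul]
    exact hc.measurable_mk.mul ((Measure.measurable_coe hA).comp hκ.measurable_mk)
  · filter_upwards [hc.ae_eq_mk, hκ.ae_eq_mk] with s h1 h2
    rw [← h1, ← h2]

theorem isProbabilityMeasure_average {α X : Type*} [MeasurableSpace α] [MeasurableSpace X]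
    {m : Measure α} [IsFiniteMeasure m] (hm : m ≠ 0) {κ : α → Measure X} (hκ : AEMeasurable κ m)
    (hp : ∀ᵐ s ∂m, IsProbabilityMeasure (κ s)) :
    IsProbabilityMeasure ((m univ)⁻¹ • m.bind κ) := by
  refine ⟨?_⟩
  have h : ∫⁻ a, κ a univ ∂m = ∫⁻ _, 1 ∂m :=
    lintegral_congr_ae (hp.mono fun s hs => hs.measure_univ)
  rw [Measure.smul_apply, Measure.bind_apply MeasurableSet.univ hκ, h, lintegral_one, smul_eq_mul,
    ENNReal.inv_mul_cancel (by simpa using hm) (measure_ne_top _ _)]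

theorem integral_bind_of_bounded {α X : Type*} [MeasurableSpace α] [MeasurableSpace X]
    {m : Measure α} [IsFiniteMeasure m] {κ : α → Measure X} (hκ : AEMeasurable κ m)
    (hp : ∀ᵐ s ∂m, IsProbabilityMeasure (κ s)) {f : X → ℝ} (hf : Measurable f) {C : ℝ}
    (hC : ∀ x, |f x| ≤ C) : ∫ x, f x ∂m.bind κ = ∫ s, ∫ x, f x ∂κ s ∂m := by
  have hb : IsFiniteMeasure (m.bind κ) := by
    refine ⟨?_⟩
    rw [Measure.bind_apply MeasurableSet.univ hκ,
      lintegral_congr_ae (hp.mono fun s hs => hs.measure_univ)]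
    simp
  have hi : ∀ n : Measure X, IsFiniteMeasure n → Integrable f n := fun n _ =>
    Integrable.of_bound hf.aestronglyMeasurable C (Eventually.of_forall hC)
  have hpos : ∀ ψ : X → ℝ, Measurable ψ → (∀ x, |ψ x| ≤ C) →
      (∫⁻ x, ENNReal.ofReal (ψ x) ∂m.bind κ).toReal =
        ∫ s, (∫⁻ x, ENNReal.ofReal (ψ x) ∂κ s).toReal ∂m ∧
      Integrable (fun s => (∫⁻ x, ENNReal.ofReal (ψ x) ∂κ s).toReal) m := by
    intro ψ hψ hψC
    have hmeas : AEMeasurable (fun s => ∫⁻ x, ENNReal.ofReal (ψ x) ∂κ s) m :=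
      (Measure.measurable_lintegral hψ.ennreal_ofReal).comp_aemeasurable hκ
    have hle : ∀ᵐ s ∂m, ∫⁻ x, ENNReal.ofReal (ψ x) ∂κ s ≤ ENNReal.ofReal C := by
      filter_upwards [hp] with s hs
      calc ∫⁻ x, ENNReal.ofReal (ψ x) ∂κ s ≤ ∫⁻ _, ENNReal.ofReal C ∂κ s :=
            lintegral_mono fun x => ENNReal.ofReal_le_ofReal ((le_abs_self _).trans (hψC x))
        _ = ENNReal.ofReal C := by simp
    constructor
    · rw [Measure.lintegral_bind hκ hψ.ennreal_ofReal.aemeasurable,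
        integral_toReal hmeas (hle.mono fun s hs => hs.trans_lt ENNReal.ofReal_lt_top)]
    · refine Integrable.of_bound hmeas.ennreal_toReal.aestronglyMeasurable
        (ENNReal.ofReal C).toReal (hle.mono fun s hs => ?_)
      rw [Real.norm_of_nonneg ENNReal.toReal_nonneg]
      exact ENNReal.toReal_mono ENNReal.ofReal_ne_top hs
  obtain ⟨h1, i1⟩ := hpos f hf hC
  obtain ⟨h2, i2⟩ := hpos (fun x => -f x) hf.neg fun x => by simpa using hC x
  rw [integral_eq_lintegral_pos_part_sub_lintegral_neg_part (hi _ hb), h1, h2,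
    ← integral_sub i1 i2]
  refine integral_congr_ae (hp.mono fun s hs => ?_)
  exact (integral_eq_lintegral_pos_part_sub_lintegral_neg_part (hi _ inferInstance)).symm

variable {d : ℕ}

/-! ### The half-sphere of normalized controls -/

/-- The part `b ≥ 0` of the unit sphere of `ℝ^d × ℝ` for the norm `max (|a|, |b|)`: the set of
values of a normalized vertical relaxation. -/
def halfSphere (d : ℕ) : Set (Vec d × ℝ) := {z | ‖z‖ = 1 ∧ 0 ≤ z.2}

/-- `m` is a probability measure concentrated on `halfSphere d`. -/
def IsHalfSphereMeasure (m : Measure (Vec d × ℝ)) : Prop :=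
  IsProbabilityMeasure m ∧ ∀ᵐ z ∂m, z ∈ halfSphere d

theorem max_eq_one_of_mem_halfSphere {z : Vec d × ℝ} (hz : z ∈ halfSphere d) :
    max ‖z.1‖ z.2 = 1 := by
  have := hz.1
  rwa [Prod.norm_def, Real.norm_of_nonneg hz.2] at this

theorem one_le_of_mem_halfSphere {z : Vec d × ℝ} (hz : z ∈ halfSphere d) :
    1 ≤ z.2 + ‖z.1‖ := by
  rw [← max_eq_one_of_mem_halfSphere hz]
  exact max_le (by linarith [hz.2]) (by linarith [norm_nonneg z.1])

namespace IsHalfSphereMeasure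

variable {m : Measure (Vec d × ℝ)}

theorem integrable (hm : IsHalfSphereMeasure m) {h : Vec d × ℝ → ℝ} (hh : Continuous h) :
    Integrable h m := by
  have := hm.1
  obtain ⟨C, hC⟩ := (isCompact_closedBall (0 : Vec d × ℝ) 1).exists_bound_of_continuousOn
    hh.continuousOn
  refine Integrable.of_bound hh.aestronglyMeasurable C (hm.2.mono fun z hz => hC z ?_)
  rw [mem_closedBall_zero_iff]
  exact hz.1.le

theorem le_integral (hm : IsHalfSphereMeasure m) {h : Vec d × ℝ → ℝ} (hh : Continuous h) {C : ℝ}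
    (hC : ∀ z ∈ halfSphere d, C ≤ h z) : C ≤ ∫ z, h z ∂m := by
  have := hm.1
  simpa using integral_mono_ae (integrable_const C) (hm.integrable hh) (hm.2.mono hC)

theorem integral_le (hm : IsHalfSphereMeasure m) {h : Vec d × ℝ → ℝ} (hh : Continuous h) {C : ℝ}
    (hC : ∀ z ∈ halfSphere d, h z ≤ C) : ∫ z, h z ∂m ≤ C := by
  have := hm.1
  simpa using integral_mono_ae (hm.integrable hh) (integrable_const C) (hm.2.mono hC)

end IsHalfSphereMeasure

theorem IsNormalizedRelaxation.ae_mem_halfSphere {T S : ℝ} {u : ℝ → Vec d} {v : ℝ → ℝ}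
    {w : ℝ → Vec d} (h : IsNormalizedRelaxation T u S v w) :
    ∀ᵐ s ∂volume.restrict (Icc 0 S), (w s, v s) ∈ halfSphere d := by
  filter_upwards [h.nonneg, h.normalized] with s h0 h1
  refine ⟨?_, h0⟩
  rw [Prod.norm_def, Real.norm_of_nonneg h0, max_comm]
  exact h1

/-- The speed of a normalized relaxation vanishes almost nowhere: where
`v = 0`, also `w = v u` vanishes. -/
theorem IsNormalizedRelaxation.ae_pos {T S : ℝ} {u : ℝ → Vec d} {v : ℝ → ℝ}
    {w : ℝ → Vec d} (h : IsNormalizedRelaxation T u S v w) :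
    ∀ᵐ s ∂volume.restrict (Icc 0 S), 0 < v s := by
  filter_upwards [h.nonneg, h.normalized, h.associated] with s h0 h1 h2
  refine lt_of_le_of_ne h0 fun hv => ?_
  rw [h2, ← hv] at h1
  simp at h1

theorem IsNormalizedRelaxation.integrableOn {T S : ℝ} {u : ℝ → Vec d} {v : ℝ → ℝ}
    {w : ℝ → Vec d} (h : IsNormalizedRelaxation T u S v w) : IntegrableOn v (Icc 0 S) :=
  h.memLp_v.integrable le_top

theorem ae_extendPair {S : ℝ} {v : ℝ → ℝ} {w : ℝ → Vec d}
    (h : ∀ᵐ s ∂volume.restrict (Icc 0 S), (w s, v s) ∈ halfSphere d) :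
    ∀ᵐ s, (s ∈ Icc 0 S ∧ extendPair S v w s ∈ halfSphere d) ∨
      (s ∉ Icc 0 S ∧ extendPair S v w s = 0) := by
  filter_upwards [(ae_restrict_iff' measurableSet_Icc).1 h] with s hs
  by_cases hmem : s ∈ Icc 0 S
  · left
    rw [extendPair, indicator_of_mem hmem]
    exact ⟨hmem, hs hmem⟩
  · right
    exact ⟨hmem, by rw [extendPair, indicator_of_notMem hmem]⟩

theorem ae_norm_extendPair_le {S : ℝ} {v : ℝ → ℝ} {w : ℝ → Vec d}
    (h : ∀ᵐ s ∂volume.restrict (Icc 0 S), (w s, v s) ∈ halfSphere d) :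
    ∀ᵐ s, ‖extendPair S v w s‖ ≤ 1 := by
  filter_upwards [ae_extendPair h] with s hs
  rcases hs with ⟨-, hs⟩ | ⟨-, hs⟩
  · exact hs.1.le
  · simp [hs]

theorem measureReal_Icc_diff_le (a b : ℝ) : volume.real (Icc 0 a \ Icc 0 b) ≤ |a - b| := by
  have hsub : Icc 0 a \ Icc 0 b ⊆ Icc b a := fun s hs =>
    ⟨by by_contra h; exact hs.2 ⟨hs.1.1, (not_le.1 h).le⟩, hs.1.2⟩
  refine (measureReal_mono hsub (by simp)).trans ?_
  rw [Real.volume_real_Icc]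
  exact max_le (le_abs_self _) (abs_nonneg _)

/-! ### Young measures generated by normalized relaxations -/

section Young

variable {S : ℝ} {S' : ℕ → ℝ} {v : ℕ → ℝ → ℝ} {w : ℕ → ℝ → Vec d}
  {ν : ℝ → Measure (Vec d × ℝ)}

/-- The Young measure is carried by `halfSphere d`: it does not charge the support of compactly
supported functions vanishing there, since `[S_j, S]`, where the extended pairs leave the
half-sphere, shrinks to a point. -/
theorem GeneratesYoung.ae_isHalfSphereMeasure
    (hν : GeneratesYoung S (fun j => extendPair (S' j) (v j) (w j)) ν)
    (hS : Tendsto S' atTop (𝓝 S))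
    (hK : ∀ j, ∀ᵐ s ∂volume.restrict (Icc 0 (S' j)), (w j s, v j s) ∈ halfSphere d) :
    ∀ᵐ s ∂volume.restrict (Icc 0 S), IsHalfSphereMeasure (ν s) := by
  -- The zero set of `φ n` within the ball of radius `n` is the half-sphere.
  let φ : ℕ → Vec d × ℝ → ℝ := fun n z => (|‖z‖ - 1| + max 0 (-z.2)) * max 0 ((n : ℝ) - ‖z‖)
  have hφc : ∀ n, Continuous (φ n) := fun n => by fun_prop
  have hφ0 : ∀ n z, 0 ≤ φ n z := fun n z => by positivity
  have hφs : ∀ n, HasCompactSupport (φ n) := fun n => by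
    refine HasCompactSupport.intro (isCompact_closedBall (0 : Vec d × ℝ) n) fun z hz => ?_
    rw [mem_closedBall_zero_iff, not_le] at hz
    have : max 0 ((n : ℝ) - ‖z‖) = 0 := max_eq_left (by linarith)
    simp only [φ, this, mul_zero]
  have hφK : ∀ n, ∀ z ∈ halfSphere d, φ n z = 0 := fun n z hz => by
    have : max 0 (-z.2) = 0 := max_eq_left (by linarith [hz.2])
    simp only [φ, hz.1, this, sub_self, abs_zero, add_zero, zero_mul]
  have hint : ∀ n, ∀ᵐ s ∂volume.restrict (Icc 0 S), ∫ z, φ n z ∂ν s = 0 := by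
    intro n
    have hlim := hν.tendsto (φ n) (hφc n) (hφs n) (fun _ => 1) (by simp)
    have hzero : Tendsto (fun j => ∫ s in Icc 0 S, (1 : ℝ) * φ n (extendPair (S' j) (v j) (w j) s))
        atTop (𝓝 0) := by
      have hval : ∀ j, ∫ s in Icc 0 S, (1 : ℝ) * φ n (extendPair (S' j) (v j) (w j) s) =
          volume.real (Icc 0 S \ Icc 0 (S' j)) * φ n 0 := by
        intro j
        rw [← smul_eq_mul, ← setIntegral_const, ← integral_indicator measurableSet_Icc,
          ← integral_indicator (measurableSet_Icc.diff measurableSet_Icc)]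
        refine integral_congr_ae ?_
        filter_upwards [ae_extendPair (hK j)] with s hs
        by_cases hmem : s ∈ Icc 0 S
        · rcases hs with ⟨h1, h2⟩ | ⟨h1, h2⟩
          · rw [indicator_of_mem hmem, indicator_of_notMem (fun h => h.2 h1), hφK n _ h2, mul_zero]
          · rw [indicator_of_mem hmem, indicator_of_mem (mem_sdiff_of_mem hmem h1), h2, one_mul]
        · rw [indicator_of_notMem hmem, indicator_of_notMem fun h => hmem h.1]
      simp_rw [hval]
      have h1 : Tendsto (fun j => volume.real (Icc 0 S \ Icc 0 (S' j))) atTop (𝓝 0) := by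
        refine squeeze_zero (fun j => measureReal_nonneg) (fun j => measureReal_Icc_diff_le _ _) ?_
        simpa using ((tendsto_const_nhds (x := S)).sub hS).abs
      simpa using h1.mul_const (φ n 0)
    have heq := tendsto_nhds_unique hlim hzero
    simp only [one_mul] at heq
    have hi : ∀ᵐ s ∂volume.restrict (Icc 0 S), Integrable (φ n) (ν s) := by
      filter_upwards [hν.isYoungMeasure.isProbabilityMeasure] with s hs
      exact (hφc n).integrable_of_hasCompactSupport (hφs n)
    refine (setIntegral_eq_zero_iff_of_nonneg_ae
      (Eventually.of_forall fun s => integral_nonneg (hφ0 n)) ?_).1 heq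
    obtain ⟨C, hC⟩ := (hφs n).exists_bound_of_continuous (hφc n)
    refine Integrable.of_bound (aemeasurable_integral_family hν.isYoungMeasure.aemeasurable
      (hφc n).measurable hi).aestronglyMeasurable C ?_
    filter_upwards [hν.isYoungMeasure.isProbabilityMeasure] with s hs
    simpa using norm_integral_le_of_norm_le_const (μ := ν s) (Eventually.of_forall hC)
  filter_upwards [hν.isYoungMeasure.isProbabilityMeasure, ae_all_iff.2 hint] with s hp hs
  refine ⟨hp, ?_⟩
  have : ∀ n, ∀ᵐ z ∂ν s, φ n z = 0 := fun n =>
    (integral_eq_zero_iff_of_nonneg (hφ0 n)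
      ((hφc n).integrable_of_hasCompactSupport (hφs n))).1 (hs n)
  filter_upwards [ae_all_iff.2 this] with z hz
  obtain ⟨n, hn⟩ := exists_nat_gt ‖z‖
  have h1 : 0 < max 0 ((n : ℝ) - ‖z‖) := lt_max_of_lt_right (by linarith)
  have h2 : |‖z‖ - 1| + max 0 (-z.2) = 0 := (mul_eq_zero.1 (hz n)).resolve_right h1.ne'
  have h3 : |‖z‖ - 1| = 0 := le_antisymm (by linarith [le_max_left 0 (-z.2)]) (abs_nonneg _)
  exact ⟨by linarith [abs_eq_zero.1 h3], by
    linarith [le_max_right 0 (-z.2), abs_nonneg (‖z‖ - 1)]⟩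

/-- On bounded sequences the convergence extends to test functions of arbitrary growth. -/
theorem GeneratesYoung.tendsto_of_continuous
    (hν : GeneratesYoung S (fun j => extendPair (S' j) (v j) (w j)) ν)
    (hK : ∀ j, ∀ᵐ s ∂volume.restrict (Icc 0 (S' j)), (w j s, v j s) ∈ halfSphere d)
    (hm : ∀ᵐ s ∂volume.restrict (Icc 0 S), IsHalfSphereMeasure (ν s))
    {h : Vec d × ℝ → ℝ} (hh : Continuous h) {g : ℝ → ℝ} (hg : IntegrableOn g (Icc 0 S)) :
    Tendsto (fun j => ∫ s in Icc 0 S, g s * h (extendPair (S' j) (v j) (w j) s)) atTop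
      (𝓝 (∫ s in Icc 0 S, g s * ∫ z, h z ∂ν s)) := by
  let φ : Vec d × ℝ → ℝ := fun z => h z * max 0 (min 1 (2 - ‖z‖))
  have hφ : ∀ z, ‖z‖ ≤ 1 → φ z = h z := fun z hz => by
    have h1 : min 1 (2 - ‖z‖) = 1 := min_eq_left (by linarith)
    simp only [φ, h1, max_eq_right zero_le_one, mul_one]
  have hφs : HasCompactSupport φ := by
    refine HasCompactSupport.intro (isCompact_closedBall (0 : Vec d × ℝ) 2) fun z hz => ?_
    rw [mem_closedBall_zero_iff, not_le] at hz
    have : max 0 (min 1 (2 - ‖z‖)) = 0 :=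
      max_eq_left ((min_le_right _ _).trans (by linarith))
    simp only [φ, this, mul_zero]
  have hlim := hν.tendsto φ (by fun_prop) hφs g hg
  have h1 : ∀ j, ∫ s in Icc 0 S, g s * φ (extendPair (S' j) (v j) (w j) s) =
      ∫ s in Icc 0 S, g s * h (extendPair (S' j) (v j) (w j) s) := fun j => by
    refine integral_congr_ae (ae_restrict_of_ae ?_)
    filter_upwards [ae_norm_extendPair_le (hK j)] with s hs
    rw [hφ _ hs]
  have h2 : ∫ s in Icc 0 S, g s * ∫ z, φ z ∂ν s = ∫ s in Icc 0 S, g s * ∫ z, h z ∂ν s := by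
    refine integral_congr_ae (hm.mono fun s hs => ?_)
    have : ∫ z, φ z ∂ν s = ∫ z, h z ∂ν s := integral_congr_ae (hs.2.mono fun z hz => hφ z hz.1.le)
    simp only [this]
  simpa only [h1, h2] using hlim

theorem IsYoungMeasure.aemeasurable_integral (hν : IsYoungMeasure S ν)
    (hm : ∀ᵐ s ∂volume.restrict (Icc 0 S), IsHalfSphereMeasure (ν s))
    {h : Vec d × ℝ → ℝ} (hh : Continuous h) :
    AEMeasurable (fun s => ∫ z, h z ∂ν s) (volume.restrict (Icc 0 S)) :=
  aemeasurable_integral_family hν.aemeasurable hh.measurable (hm.mono fun _ hs => hs.integrable hh)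

theorem IsYoungMeasure.integrableOn_integral (hν : IsYoungMeasure S ν)
    (hm : ∀ᵐ s ∂volume.restrict (Icc 0 S), IsHalfSphereMeasure (ν s))
    {h : Vec d × ℝ → ℝ} (hh : Continuous h) :
    IntegrableOn (fun s => ∫ z, h z ∂ν s) (Icc 0 S) := by
  obtain ⟨C, hC⟩ := (isCompact_closedBall (0 : Vec d × ℝ) 1).exists_bound_of_continuousOn
    hh.continuousOn
  have hC' : ∀ z ∈ halfSphere d, |h z| ≤ C := fun z hz =>
    hC z (mem_closedBall_zero_iff.2 hz.1.le)
  refine Integrable.of_bound (hν.aemeasurable_integral hm hh).aestronglyMeasurable C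
    (hm.mono fun s hs => abs_le.2 ⟨?_, ?_⟩)
  · exact hs.le_integral hh fun z hz => (abs_le.1 (hC' z hz)).1
  · exact hs.integral_le hh fun z hz => (abs_le.1 (hC' z hz)).2

theorem ae_integral_snd_nonneg
    (hm : ∀ᵐ s ∂volume.restrict (Icc 0 S), IsHalfSphereMeasure (ν s)) :
    ∀ᵐ s ∂volume.restrict (Icc 0 S), 0 ≤ ∫ z, z.2 ∂ν s :=
  hm.mono fun _ hs => hs.le_integral continuous_snd fun _ hz => hz.2

theorem integrable_extendPair_snd {s₁ : ℝ} {v₁ : ℝ → ℝ} {w₁ : ℝ → Vec d}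
    (h : IntegrableOn v₁ (Icc 0 s₁)) :
    Integrable fun r => (extendPair s₁ v₁ w₁ r).2 := by
  have : (fun r => (extendPair s₁ v₁ w₁ r).2) = (Icc 0 s₁).indicator v₁ := by
    ext r
    by_cases hr : r ∈ Icc 0 s₁ <;> simp [extendPair, hr]
  rw [this]
  exact h.integrable_indicator measurableSet_Icc

theorem timeOf_extendPair {s₁ s : ℝ} {v₁ : ℝ → ℝ} {w₁ : ℝ → Vec d} (hs : s ∈ Icc 0 s₁) :
    timeOf (fun r => (extendPair s₁ v₁ w₁ r).2) s = timeOf v₁ s := by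
  refine intervalIntegral.integral_congr fun r hr => ?_
  rw [uIcc_of_le hs.1] at hr
  have : r ∈ Icc 0 s₁ := ⟨hr.1, hr.2.trans hs.2⟩
  simp [extendPair, this]

/-- The times of the relaxations converge pointwise to the time of the Young measure. -/
theorem GeneratesYoung.tendsto_timeOf
    (hν : GeneratesYoung S (fun j => extendPair (S' j) (v j) (w j)) ν)
    (hK : ∀ j, ∀ᵐ s ∂volume.restrict (Icc 0 (S' j)), (w j s, v j s) ∈ halfSphere d)
    (hm : ∀ᵐ s ∂volume.restrict (Icc 0 S), IsHalfSphereMeasure (ν s)) {s : ℝ}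
    (hs : s ∈ Icc 0 S) :
    Tendsto (fun j => timeOf (fun r => (extendPair (S' j) (v j) (w j) r).2) s) atTop
      (𝓝 (youngTime ν s)) := by
  have hconv : ∀ f : ℝ → ℝ,
      ∫ r in Icc 0 S, (Icc 0 s).indicator (fun _ => (1 : ℝ)) r * f r = timeOf f s := by
    intro f
    have : (fun r => (Icc 0 s).indicator (fun _ => (1 : ℝ)) r * f r) = (Icc 0 s).indicator f := by
      ext r
      by_cases hr : r ∈ Icc 0 s <;> simp [hr]
    rw [this, setIntegral_indicator measurableSet_Icc,
      inter_eq_right.2 (Icc_subset_Icc_right hs.2), timeOf, intervalIntegral.integral_of_le hs.1,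
      integral_Icc_eq_integral_Ioc]
  have := hν.tendsto_of_continuous hK hm continuous_snd
    (g := (Icc 0 s).indicator fun _ => 1)
    ((integrable_const _).indicator measurableSet_Icc)
  simp only [hconv (fun r => (extendPair (S' _) (v _) (w _) r).2),
    hconv (fun r => ∫ z, z.2 ∂ν r)] at this
  exact this

theorem GeneratesYoung.youngTime_end {T : ℝ} {u : ℕ → ℝ → Vec d}
    (hν : GeneratesYoung S (fun j => extendPair (S' j) (v j) (w j)) ν)
    (hS : Tendsto S' atTop (𝓝 S))
    (hrelax : ∀ j, IsNormalizedRelaxation T (u j) (S' j) (v j) (w j)) :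
    youngTime ν S = T := by
  have hK := fun j => (hrelax j).ae_mem_halfSphere
  have hS0 : 0 ≤ S := ge_of_tendsto' hS fun j => (hrelax j).length_nonneg
  refine tendsto_nhds_unique (hν.tendsto_timeOf hK (hν.ae_isHalfSphereMeasure hS hK)
    ⟨hS0, le_rfl⟩) ?_
  rw [tendsto_iff_dist_tendsto_zero]
  refine squeeze_zero (fun _ => dist_nonneg) (g := fun j => |S - S' j|) (fun j => ?_)
    (by simpa using ((tendsto_const_nhds (x := S)).sub hS).abs)
  have hi := integrable_extendPair_snd (w₁ := w j) (hrelax j).integrableOn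
  have hT : T = timeOf (fun r => (extendPair (S' j) (v j) (w j) r).2) (S' j) := by
    rw [timeOf_extendPair ⟨(hrelax j).length_nonneg, le_rfl⟩, (hrelax j).time_end]
  have hsub : timeOf (fun r => (extendPair (S' j) (v j) (w j) r).2) S - T =
      ∫ r in (S' j)..S, (extendPair (S' j) (v j) (w j) r).2 := by
    conv_lhs => rw [hT]
    exact intervalIntegral.integral_interval_sub_left hi.intervalIntegrable hi.intervalIntegrable
  rw [Real.dist_eq, hsub, ← Real.norm_eq_abs]
  refine (intervalIntegral.norm_integral_le_of_norm_le_const_ae (C := 1) ?_).trans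
    (by rw [one_mul])
  filter_upwards [ae_norm_extendPair_le (hK j)] with r hr _
  exact (norm_snd_le _).trans hr

end Young

/-! ### Transport to the compactification -/

theorem coe_ratio {a : Vec d} {b : ℝ} (hb : 0 ≤ b) :
    ((ratio (a, b) : DirComp d) : Vec d) = (b + ‖a‖)⁻¹ • a := by
  rcases hb.eq_or_lt with rfl | hb
  · simp [ratio, infDir]
  · simp only [ratio, if_pos hb, toComp, norm_smul, norm_inv, Real.norm_of_nonneg hb.le, smul_smul]
    congr 1
    field_simp

theorem measurable_ratio : Measurable (ratio : Vec d × ℝ → DirComp d) := by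
  refine Measurable.ite (measurableSet_lt measurable_const measurable_snd) ?_ ?_
  · refine Measurable.subtype_mk ?_
    fun_prop
  · refine Measurable.subtype_mk ?_
    fun_prop

/-- The positively homogeneous function `(a, b) ↦ f (a / b) (b + |a|)` on `b ≥ 0`, extended to be
even in `b`. -/
noncomputable def homogExt (f : C(DirComp d, ℝ)) (z : Vec d × ℝ) : ℝ :=
  f (ratio (z.1, |z.2|)) * (|z.2| + ‖z.1‖)

theorem homogExt_of_nonneg (f : C(DirComp d, ℝ)) {z : Vec d × ℝ} (hz : 0 ≤ z.2) :
    homogExt f z = f (ratio z) * (z.2 + ‖z.1‖) := by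
  rw [homogExt, abs_of_nonneg hz]

@[simp]
theorem homogExt_zero (f : C(DirComp d, ℝ)) : homogExt f 0 = 0 := by simp [homogExt]

theorem abs_homogExt_le (f : C(DirComp d, ℝ)) (z : Vec d × ℝ) :
    |homogExt f z| ≤ ‖f‖ * (|z.2| + ‖z.1‖) := by
  have h : 0 ≤ |z.2| + ‖z.1‖ := by positivity
  rw [homogExt, abs_mul, abs_of_nonneg h]
  exact mul_le_mul_of_nonneg_right (f.norm_coe_le_norm _) h

/-- Away from the origin, `a / b = a / (b + |a|)` depends continuously on `(a, b)`; at the origin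
the factor `b + |a|` prevails. -/
theorem continuous_homogExt (f : C(DirComp d, ℝ)) : Continuous (homogExt f) := by
  rw [continuous_iff_continuousAt]
  intro z
  by_cases hz : z = 0
  · subst hz
    rw [ContinuousAt, homogExt_zero]
    refine squeeze_zero_norm (abs_homogExt_le f) ?_
    have : Continuous fun z : Vec d × ℝ => ‖f‖ * (|z.2| + ‖z.1‖) := by fun_prop
    simpa using this.tendsto 0
  · have hne : |z.2| + ‖z.1‖ ≠ 0 := by
      intro h0
      have h1 : |z.2| = 0 := by linarith [abs_nonneg z.2, norm_nonneg z.1]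
      have h2 : ‖z.1‖ = 0 := by linarith
      exact hz (Prod.ext (norm_eq_zero.1 h2) (abs_eq_zero.1 h1))
    have hr : ContinuousAt (fun z : Vec d × ℝ => ratio (z.1, |z.2|)) z := by
      rw [Topology.IsInducing.subtypeVal.continuousAt_iff]
      have : (Subtype.val ∘ fun z : Vec d × ℝ => ratio (z.1, |z.2|)) =
          fun z : Vec d × ℝ => (|z.2| + ‖z.1‖)⁻¹ • z.1 := by
        ext1 z
        exact coe_ratio (abs_nonneg _)
      rw [this]
      have hc : Continuous fun z : Vec d × ℝ => |z.2| + ‖z.1‖ := by fun_prop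
      exact (hc.continuousAt.inv₀ hne).smul continuous_fst.continuousAt
    have hc : Continuous fun z : Vec d × ℝ => |z.2| + ‖z.1‖ := by fun_prop
    exact (f.continuous.continuousAt.comp hr).mul hc.continuousAt

section Transport

variable {ν : ℝ → Measure (Vec d × ℝ)}

theorem continuous_norm_add_abs : Continuous fun z : Vec d × ℝ => ‖z.1‖ + |z.2| := by fun_prop

theorem one_le_rho {s : ℝ} (hs : IsHalfSphereMeasure (ν s)) : 1 ≤ rho ν s :=
  hs.le_integral continuous_norm_add_abs fun z hz => by
    rw [abs_of_nonneg hz.2, add_comm]; exact one_le_of_mem_halfSphere hz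

theorem rho_nonneg (s : ℝ) : 0 ≤ rho ν s := integral_nonneg fun _ => by positivity

/-- If the speed vanishes on average, then `b = 0` and hence `|a| = 1` almost surely. -/
theorem rho_eq_one {s : ℝ} (hs : IsHalfSphereMeasure (ν s)) (h0 : ∫ z, z.2 ∂ν s = 0) :
    rho ν s = 1 := by
  have := hs.1
  have hb : ∀ᵐ z ∂ν s, z.2 = 0 :=
    (integral_eq_zero_iff_of_nonneg_ae (hs.2.mono fun z hz => hz.2)
      (hs.integrable continuous_snd)).1 h0
  have : rho ν s = ∫ _, (1 : ℝ) ∂ν s := by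
    refine integral_congr_ae ?_
    filter_upwards [hb, hs.2] with z hz hz'
    have := max_eq_one_of_mem_halfSphere hz'
    rw [hz, max_eq_left (norm_nonneg _)] at this
    simp [hz, this]
  rw [this]; simp

theorem transported_eq_smul (s : ℝ) : transported ν s = ENNReal.ofReal (rho ν s)⁻¹ •
    ((ν s).withDensity fun z => ENNReal.ofReal (z.2 + ‖z.1‖)).map ratio := by
  have hq : Measurable fun z : Vec d × ℝ => ENNReal.ofReal (z.2 + ‖z.1‖) := by fun_prop
  rw [transported, ← Measure.map_smul, ← withDensity_smul _ hq]
  congr 2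
  ext z
  rw [ENNReal.ofReal_mul (inv_nonneg.2 (rho_nonneg s)), Pi.smul_apply, smul_eq_mul]

theorem aemeasurable_transported {S : ℝ} (hν : IsYoungMeasure S ν)
    (hm : ∀ᵐ s ∂volume.restrict (Icc 0 S), IsHalfSphereMeasure (ν s)) :
    AEMeasurable (transported ν) (volume.restrict (Icc 0 S)) := by
  have hq : Measurable fun z : Vec d × ℝ => ENNReal.ofReal (z.2 + ‖z.1‖) := by fun_prop
  rw [funext transported_eq_smul]
  refine aemeasurable_smul_family ?_
    (hν.aemeasurable_integral hm continuous_norm_add_abs).inv.ennreal_ofReal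
  exact (Measure.measurable_map _ measurable_ratio).comp_aemeasurable
    ((measurable_withDensity_left hq).comp_aemeasurable hν.aemeasurable)

theorem integral_transported {s : ℝ} (hs : IsHalfSphereMeasure (ν s)) (f : C(DirComp d, ℝ)) :
    ∫ y, f y ∂transported ν s = ∫ z, (rho ν s)⁻¹ * f (ratio z) * (z.2 + ‖z.1‖) ∂ν s := by
  have hq : Measurable fun z : Vec d × ℝ =>
      ENNReal.ofReal ((rho ν s)⁻¹ * (z.2 + ‖z.1‖)) := by fun_prop
  rw [transported, integral_map measurable_ratio.aemeasurable
      f.continuous.aestronglyMeasurable,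
    integral_withDensity_eq_integral_toReal_smul hq
      (Eventually.of_forall fun _ => ENNReal.ofReal_lt_top)]
  refine integral_congr_ae (hs.2.mono fun z hz => ?_)
  have : 0 ≤ (rho ν s)⁻¹ * (z.2 + ‖z.1‖) :=
    mul_nonneg (inv_nonneg.2 (rho_nonneg s)) (by linarith [one_le_of_mem_halfSphere hz])
  simp only [ENNReal.toReal_ofReal this, smul_eq_mul]
  ring

theorem integral_transported' {s : ℝ} (hs : IsHalfSphereMeasure (ν s)) (f : C(DirComp d, ℝ)) :
    ∫ y, f y ∂transported ν s = (rho ν s)⁻¹ * ∫ z, f (ratio z) * (z.2 + ‖z.1‖) ∂ν s := by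
  simp_rw [integral_transported hs, mul_assoc, integral_const_mul]

theorem rho_mul_integral_transported {s : ℝ} (hs : IsHalfSphereMeasure (ν s))
    (f : C(DirComp d, ℝ)) :
    rho ν s * ∫ y, f y ∂transported ν s = ∫ z, homogExt f z ∂ν s := by
  have h : rho ν s ≠ 0 := by linarith [one_le_rho hs]
  rw [integral_transported' hs, mul_inv_cancel_left₀ h]
  exact integral_congr_ae (hs.2.mono fun z hz => (homogExt_of_nonneg f hz.2).symm)

theorem isProbabilityMeasure_transported {s : ℝ} (hs : IsHalfSphereMeasure (ν s)) :
    IsProbabilityMeasure (transported ν s) := by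
  have h : rho ν s ≠ 0 := by linarith [one_le_rho hs]
  have hc : Continuous fun z : Vec d × ℝ => (rho ν s)⁻¹ * (z.2 + ‖z.1‖) := by fun_prop
  refine ⟨?_⟩
  rw [transported, Measure.map_apply measurable_ratio MeasurableSet.univ, preimage_univ,
    withDensity_apply _ MeasurableSet.univ, Measure.restrict_univ,
    ← ofReal_integral_eq_lintegral_ofReal (hs.integrable hc) (hs.2.mono fun z hz =>
      mul_nonneg (inv_nonneg.2 (rho_nonneg s)) (by linarith [one_le_of_mem_halfSphere hz])),
    integral_const_mul]
  have : ∫ z, (z.2 + ‖z.1‖) ∂ν s = rho ν s := by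
    refine integral_congr_ae (hs.2.mono fun z hz => ?_)
    simp only [abs_of_nonneg hz.2, add_comm]
  rw [this, inv_mul_cancel₀ h, ENNReal.ofReal_one]

end Transport

/-! ### The fibres of the time and the measure `σ` -/

section Limit

variable {S : ℝ} {ν : ℝ → Measure (Vec d × ℝ)}

theorem monotoneOn_youngTime (hν : IsYoungMeasure S ν)
    (hm : ∀ᵐ s ∂volume.restrict (Icc 0 S), IsHalfSphereMeasure (ν s)) :
    MonotoneOn (youngTime ν) (Icc 0 S) :=
  monotoneOn_timeOf (hν.integrableOn_integral hm continuous_snd) (ae_integral_snd_nonneg hm)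

theorem continuousOn_youngTime (hS : 0 ≤ S) (hν : IsYoungMeasure S ν)
    (hm : ∀ᵐ s ∂volume.restrict (Icc 0 S), IsHalfSphereMeasure (ν s)) :
    ContinuousOn (youngTime ν) (Icc 0 S) :=
  continuousOn_timeOf hS (hν.integrableOn_integral hm continuous_snd)

theorem image_youngTime (hS : 0 ≤ S) (hν : IsYoungMeasure S ν)
    (hm : ∀ᵐ s ∂volume.restrict (Icc 0 S), IsHalfSphereMeasure (ν s)) :
    youngTime ν '' Icc 0 S = Icc 0 (youngTime ν S) :=
  image_timeOf hS (hν.integrableOn_integral hm continuous_snd) (ae_integral_snd_nonneg hm)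

theorem exists_fibre_eq_Icc (hS : 0 ≤ S) (hν : IsYoungMeasure S ν)
    (hm : ∀ᵐ s ∂volume.restrict (Icc 0 S), IsHalfSphereMeasure (ν s)) {t : ℝ}
    (ht : t ∈ Icc 0 (youngTime ν S)) : ∃ c e, c ≤ e ∧ fibre S ν t = Icc c e := by
  rw [← image_youngTime hS hν hm] at ht
  exact exists_preimage_eq_Icc (monotoneOn_youngTime hν hm) (continuousOn_youngTime hS hν hm) ht

/-- The times whose fibre is a nondegenerate interval. -/
def jumpTimes (S : ℝ) (ν : ℝ → Measure (Vec d × ℝ)) : Set ℝ := {t | ¬(fibre S ν t).Subsingleton}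

theorem countable_jumpTimes (hν : IsYoungMeasure S ν)
    (hm : ∀ᵐ s ∂volume.restrict (Icc 0 S), IsHalfSphereMeasure (ν s)) :
    (jumpTimes S ν).Countable := by
  refine (monotoneOn_youngTime hν hm).countable_setOfPred_two_preimages.mono fun t ht => ?_
  obtain ⟨x, hx, y, hy, hxy⟩ := (not_subsingleton_iff.1 ht).exists_lt
  exact ⟨x, y, hx.1, hy.1, hxy, hx.2, hy.2⟩

theorem exists_fibre_eq_Icc_of_mem_jumpTimes (hS : 0 ≤ S) (hν : IsYoungMeasure S ν)
    (hm : ∀ᵐ s ∂volume.restrict (Icc 0 S), IsHalfSphereMeasure (ν s)) {t : ℝ}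
    (ht : t ∈ jumpTimes S ν) : ∃ c e, c < e ∧ fibre S ν t = Icc c e := by
  obtain ⟨s, hs⟩ := (not_subsingleton_iff.1 ht).nonempty
  have htm : t ∈ Icc 0 (youngTime ν S) := by
    rw [← image_youngTime hS hν hm]
    exact ⟨s, hs⟩
  obtain ⟨c, e, hce, h⟩ := exists_fibre_eq_Icc hS hν hm htm
  refine ⟨c, e, hce.lt_of_ne ?_, h⟩
  rintro rfl
  refine ht ?_
  rw [h, Icc_self]
  exact subsingleton_singleton

theorem monotoneOn_sInf_fibre (hS : 0 ≤ S) (hν : IsYoungMeasure S ν)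
    (hm : ∀ᵐ s ∂volume.restrict (Icc 0 S), IsHalfSphereMeasure (ν s)) :
    MonotoneOn (fun t => sInf (fibre S ν t)) (Icc 0 (youngTime ν S)) := by
  have hmem : ∀ t ∈ Icc 0 (youngTime ν S), sInf (fibre S ν t) ∈ fibre S ν t := by
    intro t ht
    obtain ⟨c, e, hce, h⟩ := exists_fibre_eq_Icc hS hν hm ht
    rw [h, csInf_Icc hce]
    exact ⟨le_rfl, hce⟩
  intro t ht t' ht' htt'
  rcases htt'.eq_or_lt with rfl | hlt
  · exact le_rfl
  by_contra hcon
  have h1 := monotoneOn_youngTime hν hm (hmem t' ht').1 (hmem t ht).1 (not_le.1 hcon).le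
  rw [(hmem t ht).2, (hmem t' ht').2] at h1
  exact absurd h1 (not_le.2 hlt)

theorem fibre_youngTime_of_notMem_jumpTimes {s : ℝ} (hs : s ∈ Icc 0 S)
    (h : youngTime ν s ∉ jumpTimes S ν) : fibre S ν (youngTime ν s) = {s} :=
  (not_not.1 h).eq_singleton_of_mem ⟨hs, rfl⟩

/-- The measure `ρ(s) ds` on `[0, S]`. -/
noncomputable def rhoMeasure (S : ℝ) (ν : ℝ → Measure (Vec d × ℝ)) : Measure ℝ :=
  (volume.restrict (Icc 0 S)).withDensity fun s => ENNReal.ofReal (rho ν s)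

theorem dpmSigma_eq_map : dpmSigma S ν = (rhoMeasure S ν).map (youngTime ν) := rfl

theorem rhoMeasure_absolutelyContinuous : rhoMeasure S ν ≪ volume.restrict (Icc 0 S) :=
  withDensity_absolutelyContinuous _ _

theorem integrableOn_rho (hν : IsYoungMeasure S ν)
    (hm : ∀ᵐ s ∂volume.restrict (Icc 0 S), IsHalfSphereMeasure (ν s)) :
    IntegrableOn (rho ν) (Icc 0 S) :=
  hν.integrableOn_integral hm continuous_norm_add_abs

theorem aemeasurable_ofReal_rho (hν : IsYoungMeasure S ν)
    (hm : ∀ᵐ s ∂volume.restrict (Icc 0 S), IsHalfSphereMeasure (ν s)) :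
    AEMeasurable (fun s => ENNReal.ofReal (rho ν s)) (volume.restrict (Icc 0 S)) :=
  (integrableOn_rho hν hm).1.aemeasurable.ennreal_ofReal

theorem absolutelyContinuous_rhoMeasure (hν : IsYoungMeasure S ν)
    (hm : ∀ᵐ s ∂volume.restrict (Icc 0 S), IsHalfSphereMeasure (ν s)) :
    volume.restrict (Icc 0 S) ≪ rhoMeasure S ν := by
  refine withDensity_absolutelyContinuous'
    (aemeasurable_ofReal_rho hν hm) (hm.mono fun s hs => ?_)
  rw [ENNReal.ofReal_ne_zero_iff]
  linarith [one_le_rho hs]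

theorem isFiniteMeasure_rhoMeasure (hν : IsYoungMeasure S ν)
    (hm : ∀ᵐ s ∂volume.restrict (Icc 0 S), IsHalfSphereMeasure (ν s)) :
    IsFiniteMeasure (rhoMeasure S ν) :=
  isFiniteMeasure_withDensity_ofReal (integrableOn_rho hν hm).2

theorem aemeasurable_youngTime (hS : 0 ≤ S) (hν : IsYoungMeasure S ν)
    (hm : ∀ᵐ s ∂volume.restrict (Icc 0 S), IsHalfSphereMeasure (ν s)) :
    AEMeasurable (youngTime ν) (rhoMeasure S ν) :=
  ((continuousOn_youngTime hS hν hm).aemeasurable measurableSet_Icc).mono_ac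
    rhoMeasure_absolutelyContinuous

theorem ae_comp_youngTime (hS : 0 ≤ S) (hν : IsYoungMeasure S ν)
    (hm : ∀ᵐ s ∂volume.restrict (Icc 0 S), IsHalfSphereMeasure (ν s)) {p : ℝ → Prop}
    (hp : ∀ᵐ t ∂dpmSigma S ν, p t) : ∀ᵐ s ∂volume.restrict (Icc 0 S), p (youngTime ν s) :=
  (absolutelyContinuous_rhoMeasure hν hm).ae_le
    (ae_of_ae_map (aemeasurable_youngTime hS hν hm) hp)

theorem ae_dpmSigma_mem (hS : 0 ≤ S) (hν : IsYoungMeasure S ν)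
    (hm : ∀ᵐ s ∂volume.restrict (Icc 0 S), IsHalfSphereMeasure (ν s)) :
    ∀ᵐ t ∂dpmSigma S ν, t ∈ Icc 0 (youngTime ν S) := by
  refine (ae_map_iff (p := fun t => t ∈ Icc 0 (youngTime ν S)) (aemeasurable_youngTime hS hν hm)
    measurableSet_Icc).2 ?_
  filter_upwards [rhoMeasure_absolutelyContinuous.ae_le (ae_restrict_mem measurableSet_Icc)]
    with s hs
  rw [← image_youngTime hS hν hm]
  exact mem_image_of_mem _ hs

theorem restrict_dpmSigma (hS : 0 ≤ S) (hν : IsYoungMeasure S ν)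
    (hm : ∀ᵐ s ∂volume.restrict (Icc 0 S), IsHalfSphereMeasure (ν s)) :
    (dpmSigma S ν).restrict (Icc 0 (youngTime ν S)) = dpmSigma S ν :=
  Measure.restrict_eq_self_of_ae_mem (ae_dpmSigma_mem hS hν hm)

theorem integral_dpmSigma (hS : 0 ≤ S) (hν : IsYoungMeasure S ν)
    (hm : ∀ᵐ s ∂volume.restrict (Icc 0 S), IsHalfSphereMeasure (ν s)) {F : ℝ → ℝ}
    (hF : AEStronglyMeasurable F (dpmSigma S ν)) :
    ∫ t in Icc 0 (youngTime ν S), F t ∂dpmSigma S ν =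
      ∫ s in Icc 0 S, rho ν s * F (youngTime ν s) := by
  rw [restrict_dpmSigma hS hν hm]
  rw [dpmSigma_eq_map] at hF ⊢
  rw [integral_map (aemeasurable_youngTime hS hν hm) hF, rhoMeasure,
    integral_withDensity_eq_integral_toReal_smul₀ (aemeasurable_ofReal_rho hν hm)
      (Eventually.of_forall fun _ => ENNReal.ofReal_lt_top)]
  refine integral_congr_ae (Eventually.of_forall fun s => ?_)
  simp only [ENNReal.toReal_ofReal (rho_nonneg s), smul_eq_mul]

theorem aemeasurable_sInf_fibre (hS : 0 ≤ S) (hν : IsYoungMeasure S ν)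
    (hm : ∀ᵐ s ∂volume.restrict (Icc 0 S), IsHalfSphereMeasure (ν s)) :
    AEMeasurable (fun t => sInf (fibre S ν t)) (dpmSigma S ν) := by
  have := aemeasurable_restrict_of_monotoneOn (μ := dpmSigma S ν) measurableSet_Icc
    (monotoneOn_sInf_fibre hS hν hm)
  rwa [restrict_dpmSigma hS hν hm] at this

/-- A property of almost every `s` holds for `σ`-almost every point fibre `{s}`. The image of a
null set under the time need not be `σ`-measurable; its part outside the jump times is
the preimage of the null set under the monotone function `t ↦ inf t̃⁻¹(t)`. -/
theorem ae_dpmSigma_of_ae (hS : 0 ≤ S) (hν : IsYoungMeasure S ν)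
    (hm : ∀ᵐ s ∂volume.restrict (Icc 0 S), IsHalfSphereMeasure (ν s)) {p : ℝ → Prop}
    (hp : ∀ᵐ s ∂volume.restrict (Icc 0 S), p s) :
    ∀ᵐ t ∂dpmSigma S ν, t ∉ jumpTimes S ν → p (sInf (fibre S ν t)) := by
  have hr := aemeasurable_sInf_fibre hS hν hm
  set N := toMeasurable (volume.restrict (Icc 0 S)) {s | ¬p s} with hN
  have hN0 : ∀ᵐ s ∂volume.restrict (Icc 0 S), s ∉ N := by
    rw [← measure_eq_zero_iff_ae_notMem, measure_toMeasurable]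
    exact hp
  have hNp : ∀ s, s ∉ N → p s := fun s hs =>
    by_contra fun h => hs (subset_toMeasurable _ _ h)
  have hset : MeasurableSet {t | t ∉ jumpTimes S ν → hr.mk _ t ∉ N} := by
    have h1 := (countable_jumpTimes hν hm).measurableSet
    have h2 : MeasurableSet (hr.mk _ ⁻¹' N) := hr.measurable_mk (measurableSet_toMeasurable _ _)
    have : {t | t ∉ jumpTimes S ν → hr.mk _ t ∉ N} = jumpTimes S ν ∪ (hr.mk _ ⁻¹' N)ᶜ := by
      ext t
      simp only [mem_ofPred_eq, mem_union, mem_compl_iff, mem_preimage]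
      tauto
    rw [this]
    exact h1.union h2.compl
  have hmain : ∀ᵐ t ∂dpmSigma S ν, t ∉ jumpTimes S ν → hr.mk _ t ∉ N := by
    have hτ := aemeasurable_youngTime hS hν hm
    refine (ae_map_iff hτ hset).2 ?_
    filter_upwards [ae_of_ae_map hτ hr.ae_eq_mk, rhoMeasure_absolutelyContinuous.ae_le hN0,
      rhoMeasure_absolutelyContinuous.ae_le (ae_restrict_mem measurableSet_Icc)] with s h1 h2 h3 h4
    rw [← h1, fibre_youngTime_of_notMem_jumpTimes h3 h4, csInf_singleton]
    exact h2
  filter_upwards [hmain, hr.ae_eq_mk] with t h1 h2 h3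
  refine hNp _ ?_
  rw [h2]
  exact h1 h3

/-! ### The family `μ` -/

theorem dpmMu_of_notMem_jumpTimes {t : ℝ} (ht : t ∉ jumpTimes S ν) :
    dpmMu S ν t = transported ν (sInf (fibre S ν t)) := by
  rw [dpmMu, if_pos (not_not.1 ht)]

theorem not_subsingleton_Icc {c e : ℝ} (hce : c < e) : ¬(Icc c e).Subsingleton := fun h =>
  hce.ne (h ⟨le_rfl, hce.le⟩ ⟨hce.le, le_rfl⟩)

theorem dpmMu_of_fibre_eq_Icc {t c e : ℝ} (hce : c < e) (h : fibre S ν t = Icc c e) :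
    dpmMu S ν t =
      (volume.restrict (Icc c e) univ)⁻¹ • (volume.restrict (Icc c e)).bind (transported ν) := by
  rw [dpmMu, if_neg (h ▸ not_subsingleton_Icc hce), h, Measure.restrict_apply_univ]

theorem fibre_subset (t : ℝ) : fibre S ν t ⊆ Icc 0 S := fun _ hs => hs.1

theorem isProbabilityMeasure_dpmMu_of_fibre_eq_Icc (hν : IsYoungMeasure S ν)
    (hm : ∀ᵐ s ∂volume.restrict (Icc 0 S), IsHalfSphereMeasure (ν s)) {t c e : ℝ} (hce : c < e)
    (h : fibre S ν t = Icc c e) : IsProbabilityMeasure (dpmMu S ν t) := by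
  have hsub : Icc c e ⊆ Icc 0 S := h ▸ fibre_subset t
  rw [dpmMu_of_fibre_eq_Icc hce h]
  refine isProbabilityMeasure_average ?_ ((aemeasurable_transported hν hm).mono_set hsub)
    ((ae_restrict_of_ae_restrict_of_subset hsub hm).mono fun s hs =>
      isProbabilityMeasure_transported hs)
  rw [Ne, Measure.restrict_eq_zero, Real.volume_Icc]
  simpa using hce

theorem integral_dpmMu_of_fibre_eq_Icc (hν : IsYoungMeasure S ν)
    (hm : ∀ᵐ s ∂volume.restrict (Icc 0 S), IsHalfSphereMeasure (ν s)) {t c e : ℝ} (hce : c < e)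
    (h : fibre S ν t = Icc c e) (f : C(DirComp d, ℝ)) :
    ∫ y, f y ∂dpmMu S ν t = ⨍ s in Icc c e, ∫ y, f y ∂transported ν s := by
  have hsub : Icc c e ⊆ Icc 0 S := h ▸ fibre_subset t
  rw [dpmMu_of_fibre_eq_Icc hce h, integral_smul_measure,
    integral_bind_of_bounded ((aemeasurable_transported hν hm).mono_set hsub)
      ((ae_restrict_of_ae_restrict_of_subset hsub hm).mono fun s hs =>
        isProbabilityMeasure_transported hs) f.continuous.measurable
      (fun x => f.norm_coe_le_norm x), average_eq, ENNReal.toReal_inv, Measure.real]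

theorem ae_isProbabilityMeasure_dpmMu (hS : 0 ≤ S) (hν : IsYoungMeasure S ν)
    (hm : ∀ᵐ s ∂volume.restrict (Icc 0 S), IsHalfSphereMeasure (ν s)) :
    ∀ᵐ t ∂dpmSigma S ν, IsProbabilityMeasure (dpmMu S ν t) := by
  filter_upwards [ae_dpmSigma_of_ae hS hν hm hm] with t ht
  by_cases hj : t ∈ jumpTimes S ν
  · obtain ⟨c, e, hce, h⟩ := exists_fibre_eq_Icc_of_mem_jumpTimes hS hν hm hj
    exact isProbabilityMeasure_dpmMu_of_fibre_eq_Icc hν hm hce h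
  · rw [dpmMu_of_notMem_jumpTimes hj]
    exact isProbabilityMeasure_transported (ht hj)

theorem aemeasurable_dpmMu (hS : 0 ≤ S) (hν : IsYoungMeasure S ν)
    (hm : ∀ᵐ s ∂volume.restrict (Icc 0 S), IsHalfSphereMeasure (ν s)) :
    AEMeasurable (dpmMu S ν) (dpmSigma S ν) := by
  classical
  have hr := aemeasurable_sInf_fibre hS hν hm
  have hk := aemeasurable_transported hν hm
  have hmeas : Measurable fun t => hk.mk _ (hr.mk _ t) := hk.measurable_mk.comp hr.measurable_mk
  -- On the countable set of jump times the values do not affect measurability.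
  refine ⟨fun t => if t ∈ jumpTimes S ν then dpmMu S ν t else hk.mk _ (hr.mk _ t),
    hmeas.measurable_of_countable_ne ((countable_jumpTimes hν hm).mono fun t ht => ?_), ?_⟩
  · by_contra hj
    exact ht (if_neg hj).symm
  · filter_upwards [ae_dpmSigma_of_ae hS hν hm hk.ae_eq_mk, hr.ae_eq_mk] with t h1 h2
    by_cases hj : t ∈ jumpTimes S ν
    · rw [if_pos hj]
    · rw [if_neg hj, dpmMu_of_notMem_jumpTimes hj, h1 hj, h2]

theorem isDiPernaMajda_dpm (hS : 0 ≤ S) (hν : IsYoungMeasure S ν)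
    (hm : ∀ᵐ s ∂volume.restrict (Icc 0 S), IsHalfSphereMeasure (ν s)) :
    IsDiPernaMajda (youngTime ν S) (dpmSigma S ν) (dpmMu S ν) where
  isFiniteMeasure := by
    have := isFiniteMeasure_rhoMeasure hν hm
    rw [dpmSigma_eq_map]
    infer_instance
  concentrated := ae_dpmSigma_mem hS hν hm
  aemeasurable := aemeasurable_dpmMu hS hν hm
  isProbabilityMeasure := ae_isProbabilityMeasure_dpmMu hS hν hm

/-- On a nondegenerate fibre the time is constant, so `b = 0` there and the normalization forces
`ρ = 1`. -/
theorem ae_rho_eq_one_of_fibre_eq_Icc (hν : IsYoungMeasure S ν)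
    (hm : ∀ᵐ s ∂volume.restrict (Icc 0 S), IsHalfSphereMeasure (ν s)) {t c e : ℝ} (hce : c < e)
    (h : fibre S ν t = Icc c e) : ∀ᵐ s ∂volume.restrict (Icc c e), rho ν s = 1 := by
  have hsub : Icc c e ⊆ Icc 0 S := h ▸ fibre_subset t
  have hi := hν.integrableOn_integral hm continuous_snd
  have hc : c ∈ fibre S ν t := h ▸ ⟨le_rfl, hce.le⟩
  have he : e ∈ fibre S ν t := h ▸ ⟨hce.le, le_rfl⟩
  have h0 : ∫ s in Icc c e, ∫ z, z.2 ∂ν s = 0 := by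
    rw [integral_Icc_eq_integral_Ioc, ← intervalIntegral.integral_of_le hce.le,
      ← timeOf_sub hi hc.1 he.1]
    exact sub_eq_zero.2 (he.2.trans hc.2.symm)
  have hz := (setIntegral_eq_zero_iff_of_nonneg_ae
    (ae_restrict_of_ae_restrict_of_subset hsub (ae_integral_snd_nonneg hm))
    (hi.mono_set hsub)).1 h0
  filter_upwards [hz, ae_restrict_of_ae_restrict_of_subset hsub hm] with s h1 h2
  exact rho_eq_one h2 h1

theorem aestronglyMeasurable_integral_dpmMu (hS : 0 ≤ S) (hν : IsYoungMeasure S ν)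
    (hm : ∀ᵐ s ∂volume.restrict (Icc 0 S), IsHalfSphereMeasure (ν s)) (f : C(DirComp d, ℝ)) :
    AEStronglyMeasurable (fun t => ∫ y, f y ∂dpmMu S ν t) (dpmSigma S ν) := by
  refine (aemeasurable_integral_family (aemeasurable_dpmMu hS hν hm) f.continuous.measurable
    ?_).aestronglyMeasurable
  filter_upwards [ae_isProbabilityMeasure_dpmMu hS hν hm] with t ht
  exact Integrable.of_bound f.continuous.aestronglyMeasurable ‖f‖
    (Eventually.of_forall f.norm_coe_le_norm)

theorem integrableOn_integral_dpmMu_mul_rho (hS : 0 ≤ S) (hν : IsYoungMeasure S ν)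
    (hm : ∀ᵐ s ∂volume.restrict (Icc 0 S), IsHalfSphereMeasure (ν s)) (f : C(DirComp d, ℝ)) :
    IntegrableOn (fun s => (∫ y, f y ∂dpmMu S ν (youngTime ν s)) * rho ν s) (Icc 0 S) := by
  have hFm : AEStronglyMeasurable (fun t => ∫ y, f y ∂dpmMu S ν t)
      ((rhoMeasure S ν).map (youngTime ν)) := aestronglyMeasurable_integral_dpmMu hS hν hm f
  have hFτm : AEStronglyMeasurable (fun s => ∫ y, f y ∂dpmMu S ν (youngTime ν s))
      (volume.restrict (Icc 0 S)) :=
    (hFm.comp_aemeasurable (aemeasurable_youngTime hS hν hm)).mono_ac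
      (absolutelyContinuous_rhoMeasure hν hm)
  refine (integrableOn_rho hν hm).bdd_mul hFτm (c := ‖f‖) ?_
  refine ae_comp_youngTime hS hν hm (p := fun t => ‖∫ y, f y ∂dpmMu S ν t‖ ≤ ‖f‖) ?_
  filter_upwards [ae_isProbabilityMeasure_dpmMu hS hν hm] with t ht
  simpa using norm_integral_le_of_norm_le_const (μ := dpmMu S ν t)
    (Eventually.of_forall f.norm_coe_le_norm)

/-- Since `ρ = 1` on a nondegenerate fibre, replacing the transported measures by their uniform
average leaves the integral over the fibre unchanged. -/
theorem integral_fibre_sub_eq_zero (hν : IsYoungMeasure S ν)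
    (hm : ∀ᵐ s ∂volume.restrict (Icc 0 S), IsHalfSphereMeasure (ν s)) {t c e : ℝ} (hce : c < e)
    (h : fibre S ν t = Icc c e) (f : C(DirComp d, ℝ)) :
    ∫ s in Icc c e, ((∫ y, f y ∂dpmMu S ν t) * rho ν s - ∫ z, homogExt f z ∂ν s) = 0 := by
  have hsub : Icc c e ⊆ Icc 0 S := h ▸ fibre_subset t
  have hmI := ae_restrict_of_ae_restrict_of_subset hsub hm
  have hρ := ae_rho_eq_one_of_fibre_eq_Icc hν hm hce h
  have hJi := (hν.integrableOn_integral hm (continuous_homogExt f)).mono_set hsub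
  have hFt : ∫ y, f y ∂dpmMu S ν t = ⨍ s in Icc c e, ∫ z, homogExt f z ∂ν s := by
    rw [integral_dpmMu_of_fibre_eq_Icc hν hm hce h f]
    refine average_congr ?_
    filter_upwards [hmI, hρ] with s h1 h2
    rw [← rho_mul_integral_transported h1, h2, one_mul]
  have hne : volume.real (Icc c e) ≠ 0 := by
    rw [Real.volume_real_Icc_of_le hce.le]
    exact sub_ne_zero.2 hce.ne'
  calc ∫ s in Icc c e, ((∫ y, f y ∂dpmMu S ν t) * rho ν s - ∫ z, homogExt f z ∂ν s)
      = ∫ s in Icc c e, ((∫ y, f y ∂dpmMu S ν t) - ∫ z, homogExt f z ∂ν s) :=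
        integral_congr_ae (hρ.mono fun s hs => by simp only [hs, mul_one])
    _ = 0 := by
        rw [integral_sub (integrable_const _) hJi, setIntegral_const, hFt, setAverage_eq,
          smul_smul, mul_inv_cancel₀ hne, one_smul, sub_self]

/-- An integral over `[0, S]` vanishes if the integrand vanishes on the point fibres and has
integral zero over each of the countably many nondegenerate fibres. -/
theorem setIntegral_eq_zero_of_fibres (hS : 0 ≤ S) (hν : IsYoungMeasure S ν)
    (hm : ∀ᵐ s ∂volume.restrict (Icc 0 S), IsHalfSphereMeasure (ν s)) {H : ℝ → ℝ}
    (hH : IntegrableOn H (Icc 0 S))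
    (hpoint : ∀ᵐ s ∂volume.restrict (Icc 0 S), youngTime ν s ∉ jumpTimes S ν → H s = 0)
    (hjump : ∀ t c e, c < e → fibre S ν t = Icc c e → ∫ s in Icc c e, H s = 0) :
    ∫ s in Icc 0 S, H s = 0 := by
  set U : Set ℝ := ⋃ t : jumpTimes S ν, fibre S ν t with hU
  have hfm : ∀ t : jumpTimes S ν, MeasurableSet (fibre S ν t) := fun t => by
    obtain ⟨c, e, -, h⟩ := exists_fibre_eq_Icc_of_mem_jumpTimes hS hν hm t.2
    rw [h]
    exact measurableSet_Icc
  have : Countable (jumpTimes S ν) := (countable_jumpTimes hν hm).to_subtype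
  have hUm : MeasurableSet U := MeasurableSet.iUnion hfm
  have hUs : U ⊆ Icc 0 S := iUnion_subset fun t => fibre_subset _
  have hU0 : ∫ s in U, H s = 0 := by
    rw [hU, integral_iUnion hfm ?_ (hH.mono_set hUs)]
    · refine (tsum_congr fun t => ?_).trans tsum_zero
      obtain ⟨c, e, hce, h⟩ := exists_fibre_eq_Icc_of_mem_jumpTimes hS hν hm t.2
      rw [h, hjump t c e hce h]
    · intro t t' htt'
      refine disjoint_left.2 fun s hs hs' => htt' (Subtype.ext ?_)
      exact hs.2.symm.trans hs'.2
  have hA0 : ∫ s in Icc 0 S \ U, H s = 0 := by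
    refine (setIntegral_congr_ae (g := fun _ => 0) (measurableSet_Icc.diff hUm) ?_).trans
      (integral_zero _ _)
    filter_upwards [(ae_restrict_iff' measurableSet_Icc).1 hpoint] with s h1 h2
    exact h1 h2.1 fun hj => h2.2 (mem_iUnion.2 ⟨⟨_, hj⟩, h2.1, rfl⟩)
  rw [← sdiff_union_of_subset hUs, setIntegral_union disjoint_sdiff_left hUm
    (hH.mono_set sdiff_subset) (hH.mono_set hUs), hA0, hU0, add_zero]

/-- The integral of `g ⊗ f` against `(σ, μ)` in terms of the Young measure: the two integrands on
`[0, S]` agree on point fibres and have the same integral over each nondegenerate fibre. -/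
theorem integral_dpm (hS : 0 ≤ S) (hν : IsYoungMeasure S ν)
    (hm : ∀ᵐ s ∂volume.restrict (Icc 0 S), IsHalfSphereMeasure (ν s)) {g : ℝ → ℝ}
    (hg : ContinuousOn g (Icc 0 (youngTime ν S))) (f : C(DirComp d, ℝ)) :
    ∫ t in Icc 0 (youngTime ν S), g t * ∫ y, f y ∂dpmMu S ν t ∂dpmSigma S ν =
      ∫ s in Icc 0 S, g (youngTime ν s) * ∫ z, homogExt f z ∂ν s := by
  have hgm : AEStronglyMeasurable g (dpmSigma S ν) := by
    have := hg.aestronglyMeasurable (μ := dpmSigma S ν) measurableSet_Icc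
    rwa [restrict_dpmSigma hS hν hm] at this
  have hgτ : ContinuousOn (fun s => g (youngTime ν s)) (Icc 0 S) :=
    hg.comp (continuousOn_youngTime hS hν hm) fun s hs => by
      rw [← image_youngTime hS hν hm]
      exact mem_image_of_mem _ hs
  have hPi := (integrableOn_integral_dpmMu_mul_rho hS hν hm f).continuousOn_mul hgτ isCompact_Icc
  have hQi := (hν.integrableOn_integral hm (continuous_homogExt f)).continuousOn_mul hgτ
    isCompact_Icc
  have hH0 := setIntegral_eq_zero_of_fibres hS hν hm (hPi.sub hQi) ?_ ?_
  · rw [integral_sub' hPi hQi, sub_eq_zero] at hH0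
    rw [integral_dpmSigma hS hν hm (F := fun t => g t * ∫ y, f y ∂dpmMu S ν t)
      (hgm.mul (aestronglyMeasurable_integral_dpmMu hS hν hm f)), ← hH0]
    refine integral_congr_ae (Eventually.of_forall fun s => ?_)
    ring
  · filter_upwards [hm, ae_restrict_mem measurableSet_Icc] with s h1 h2 hj
    simp only [Pi.sub_apply, dpmMu_of_notMem_jumpTimes hj,
      fibre_youngTime_of_notMem_jumpTimes h2 hj, csInf_singleton]
    rw [mul_comm (∫ y, f y ∂transported ν s), rho_mul_integral_transported h1, sub_self]
  · intro t c e hce h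
    refine (setIntegral_congr_fun measurableSet_Icc fun s hs => ?_).trans
      ((integral_const_mul (g t) _).trans
        (by rw [integral_fibre_sub_eq_zero hν hm hce h f, mul_zero]))
    rw [← h] at hs
    simp only [Pi.sub_apply, hs.2]
    ring

end Limit

/-! ### Passage to the limit -/

theorem continuous_toComp : Continuous (toComp : Vec d → DirComp d) := by
  have h : Continuous fun x : Vec d => 1 + ‖x‖ := by fun_prop
  refine Continuous.subtype_mk ((h.inv₀ fun x => ?_).smul continuous_id) _
  positivity

/-- The substitution `t = t̃(s)`. Since `v > 0` almost everywhere, `u (t̃(s)) = w / v`, and the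
integrand `f (u) (1 + |u|) v` becomes the homogeneous function `f (w / v) (v + |w|)`. -/
theorem IsNormalizedRelaxation.integral_eq {T S : ℝ} {u : ℝ → Vec d} {v : ℝ → ℝ}
    {w : ℝ → Vec d} (h : IsNormalizedRelaxation T u S v w) (hu : IntegrableOn u (Icc 0 T))
    {g : ℝ → ℝ} (hg : ContinuousOn g (Icc 0 T)) (f : C(DirComp d, ℝ)) :
    ∫ t in Icc 0 T, g t * f (toComp (u t)) * (1 + ‖u t‖) =
      ∫ s in Icc 0 S, g (timeOf v s) * homogExt f (w s, v s) := by
  have hF : AEStronglyMeasurable (fun t => g t * f (toComp (u t)) * (1 + ‖u t‖))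
      (volume.restrict (Icc 0 (timeOf v S))) := by
    rw [h.time_end]
    exact ((hg.aestronglyMeasurable measurableSet_Icc).mul
      ((f.continuous.comp continuous_toComp).comp_aestronglyMeasurable hu.1)).mul
      (aestronglyMeasurable_const.add hu.1.norm)
  have key := integral_comp_timeOf h.length_nonneg h.integrableOn h.nonneg hF
  rw [h.time_end] at key
  rw [key]
  refine integral_congr_ae ?_
  filter_upwards [h.ae_pos, h.associated] with s hv hw
  have hr : ratio (w s, v s) = toComp (u (timeOf v s)) := by
    simp only [ratio, if_pos hv, hw, smul_smul, inv_mul_cancel₀ hv.ne', one_smul]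
  rw [homogExt_of_nonneg f (z := (w s, v s)) hv.le, hr]
  simp only [hw, norm_smul, Real.norm_of_nonneg hv.le]
  ring

theorem abs_homogExt_le_of_norm_le (f : C(DirComp d, ℝ)) {z : Vec d × ℝ} (hz : ‖z‖ ≤ 1) :
    |homogExt f z| ≤ ‖f‖ * 2 := by
  refine (abs_homogExt_le f z).trans (mul_le_mul_of_nonneg_left ?_ (norm_nonneg f))
  have h1 : |z.2| ≤ 1 := (norm_snd_le z).trans hz
  have h2 : ‖z.1‖ ≤ 1 := (norm_fst_le z).trans hz
  linarith

theorem IsNormalizedRelaxation.aestronglyMeasurable_extendPair {T S : ℝ} {u : ℝ → Vec d}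
    {v : ℝ → ℝ} {w : ℝ → Vec d} (h : IsNormalizedRelaxation T u S v w) :
    AEStronglyMeasurable (extendPair S v w) :=
  (aestronglyMeasurable_indicator_iff measurableSet_Icc).2 (h.memLp_w.1.prodMk h.memLp_v.1)

/-- For a bounded function vanishing off `[0, b]`, the integrals over `[0, a]` and `[0, b]` differ
by at most a multiple of `|a - b|`. -/
theorem abs_setIntegral_sub_le {q : ℝ → ℝ} {a b B : ℝ} (hq : AEStronglyMeasurable q)
    (hB0 : 0 ≤ B) (hB : ∀ᵐ s, ‖q s‖ ≤ B) (h0 : ∀ s ∉ Icc 0 b, q s = 0) :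
    |(∫ s in Icc 0 b, q s) - ∫ s in Icc 0 a, q s| ≤ B * |a - b| := by
  have hi : Integrable q := by
    refine (integrableOn_iff_integrable_of_support_subset (s := Icc 0 b) fun s hs => ?_).1 ?_
    · by_contra hb
      exact hs (h0 s hb)
    · exact Integrable.of_bound hq.restrict B (ae_restrict_of_ae hB)
  have h1 : (∫ s in Icc 0 b, q s) - ∫ s in Icc 0 a, q s = ∫ s in Icc 0 b \ Icc 0 a, q s := by
    rw [setIntegral_eq_integral_of_forall_compl_eq_zero h0,
      ← integral_add_compl (measurableSet_Icc (a := 0) (b := a)) hi, add_sub_cancel_left]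
    refine setIntegral_eq_of_subset_of_forall_sdiff_eq_zero measurableSet_Icc.compl
      (fun s hs => hs.2) fun s hs => h0 s fun hb => hs.2 ⟨hb, hs.1⟩
  rw [h1, ← Real.norm_eq_abs]
  refine (norm_setIntegral_le_of_norm_le_const_ae' ((measure_mono sdiff_subset).trans_lt
    measure_Icc_lt_top) (hB.mono fun s hs _ => hs)).trans
    (mul_le_mul_of_nonneg_left ?_ hB0)
  rw [abs_sub_comm]
  exact measureReal_Icc_diff_le _ _

/-- The substituted integrals converge. The interval `[0, S_j]` may be replaced by `[0, S]` and, as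
the times converge pointwise, `t̃_j` by `t̃`; what remains is the convergence to the Young measure
with the weight `g ∘ t̃`. -/
theorem GeneratesYoung.tendsto_integral {T S : ℝ} {u : ℕ → ℝ → Vec d} {S' : ℕ → ℝ}
    {v : ℕ → ℝ → ℝ} {w : ℕ → ℝ → Vec d} {ν : ℝ → Measure (Vec d × ℝ)} (hT : 0 ≤ T)
    (hν : GeneratesYoung S (fun j => extendPair (S' j) (v j) (w j)) ν)
    (hS : Tendsto S' atTop (𝓝 S))
    (hrelax : ∀ j, IsNormalizedRelaxation T (u j) (S' j) (v j) (w j))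
    {g : ℝ → ℝ} (hg : ContinuousOn g (Icc 0 T)) (f : C(DirComp d, ℝ)) :
    Tendsto (fun j => ∫ s in Icc 0 (S' j), g (timeOf (v j) s) * homogExt f (w j s, v j s)) atTop
      (𝓝 (∫ s in Icc 0 S, g (youngTime ν s) * ∫ z, homogExt f z ∂ν s)) := by
  have hK := fun j => (hrelax j).ae_mem_halfSphere
  have hm := hν.ae_isHalfSphereMeasure hS hK
  have hY := hν.isYoungMeasure
  have hS0 : 0 ≤ S := ge_of_tendsto' hS fun j => (hrelax j).length_nonneg
  have hend : youngTime ν S = T := hν.youngTime_end hS hrelax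
  -- A bounded continuous extension `G` of `g` to the whole line.
  obtain ⟨C, hC⟩ := isCompact_Icc.exists_bound_of_continuousOn hg
  have hC0 : 0 ≤ C := (norm_nonneg _).trans (hC 0 ⟨le_rfl, hT⟩)
  let G : ℝ → ℝ := IccExtend hT ((Icc 0 T).domRestrict g)
  have hGc : Continuous G := hg.domRestrict.Icc_extend'
  have hGb : ∀ t, ‖G t‖ ≤ C := fun t => hC _ (projIcc 0 T hT t).2
  have hGg : ∀ t ∈ Icc 0 T, G t = g t := fun t ht => IccExtend_of_mem hT _ ht
  let z : ℕ → ℝ → Vec d × ℝ := fun j => extendPair (S' j) (v j) (w j)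
  let τ : ℕ → ℝ → ℝ := fun j => timeOf fun r => (z j r).2
  have hτc : ∀ j, Continuous (τ j) := fun j =>
    intervalIntegral.continuous_primitive (fun a b =>
      (integrable_extendPair_snd (w₁ := w j) (hrelax j).integrableOn).intervalIntegrable) 0
  have hzm : ∀ j, AEStronglyMeasurable (fun s => homogExt f (z j s)) := fun j =>
    (continuous_homogExt f).comp_aestronglyMeasurable (hrelax j).aestronglyMeasurable_extendPair
  have hzb : ∀ j, ∀ᵐ s, |homogExt f (z j s)| ≤ ‖f‖ * 2 := fun j =>
    (ae_norm_extendPair_le (hK j)).mono fun s hs => abs_homogExt_le_of_norm_le f hs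
  have hleft : ∀ j, ∫ s in Icc 0 (S' j), g (timeOf (v j) s) * homogExt f (w j s, v j s) =
      ∫ s in Icc 0 (S' j), G (τ j s) * homogExt f (z j s) := by
    intro j
    refine setIntegral_congr_fun measurableSet_Icc fun s hs => ?_
    have h1 : τ j s = timeOf (v j) s := timeOf_extendPair hs
    have h2 : z j s = (w j s, v j s) := indicator_of_mem hs _
    have h3 : timeOf (v j) s ∈ Icc 0 T := by
      have := mem_image_of_mem (timeOf (v j)) hs
      rwa [image_timeOf (hrelax j).length_nonneg (hrelax j).integrableOn (hrelax j).nonneg,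
        (hrelax j).time_end] at this
    simp only [h1, h2, hGg _ h3]
  have hright : ∫ s in Icc 0 S, g (youngTime ν s) * ∫ z, homogExt f z ∂ν s =
      ∫ s in Icc 0 S, G (youngTime ν s) * ∫ z, homogExt f z ∂ν s := by
    refine setIntegral_congr_fun measurableSet_Icc fun s hs => ?_
    have h3 : youngTime ν s ∈ Icc 0 T := by
      have := mem_image_of_mem (youngTime ν) hs
      rwa [image_youngTime hS0 hY hm, hend] at this
    simp only [hGg _ h3]
  have hGτ : ContinuousOn (fun s => G (youngTime ν s)) (Icc 0 S) :=
    hGc.comp_continuousOn (continuousOn_youngTime hS0 hY hm)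
  have hlim := hν.tendsto_of_continuous hK hm (continuous_homogExt f)
    (hGτ.integrableOn_compact isCompact_Icc)
  have hdiff : ∀ j, AEStronglyMeasurable
      (fun s => (G (τ j s) - G (youngTime ν s)) * homogExt f (z j s))
      (volume.restrict (Icc 0 S)) ∧ ∀ᵐ s ∂volume.restrict (Icc 0 S),
      ‖(G (τ j s) - G (youngTime ν s)) * homogExt f (z j s)‖ ≤ (C + C) * (‖f‖ * 2) := by
    refine fun j => ⟨(((hGc.comp (hτc j)).aestronglyMeasurable).sub
      (hGτ.aestronglyMeasurable measurableSet_Icc)).mul (hzm j).restrict, ?_⟩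
    filter_upwards [ae_restrict_of_ae (hzb j)] with s hs
    rw [norm_mul]
    exact mul_le_mul ((norm_sub_le _ _).trans (add_le_add (hGb _) (hGb _))) hs (norm_nonneg _)
      (by positivity)
  have hdom : Tendsto (fun j => ∫ s in Icc 0 S,
      (G (τ j s) - G (youngTime ν s)) * homogExt f (z j s)) atTop (𝓝 0) := by
    have := tendsto_integral_of_dominated_convergence (μ := volume.restrict (Icc 0 S))
      (F := fun j s => (G (τ j s) - G (youngTime ν s)) * homogExt f (z j s)) (f := fun _ => 0)
      (fun _ => (C + C) * (‖f‖ * 2))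
      (fun j => (hdiff j).1) (integrable_const _) (fun j => (hdiff j).2) ?_
    · simpa using this
    · filter_upwards [ae_restrict_mem measurableSet_Icc,
        ae_restrict_of_ae (ae_all_iff.2 hzb)] with s hs hb
      have h1 : Tendsto (fun j => G (τ j s) - G (youngTime ν s)) atTop (𝓝 0) := by
        rw [← sub_self (G (youngTime ν s))]
        exact ((hGc.tendsto _).comp (hν.tendsto_timeOf hK hm hs)).sub_const _
      exact h1.zero_mul_isBoundedUnder_le ⟨‖f‖ * 2, by simpa using ⟨0, fun j _ => hb j⟩⟩
  have hcut : Tendsto (fun j => (∫ s in Icc 0 (S' j), G (τ j s) * homogExt f (z j s)) -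
      ∫ s in Icc 0 S, G (τ j s) * homogExt f (z j s)) atTop (𝓝 0) := by
    refine squeeze_zero_norm (a := fun j => C * (‖f‖ * 2) * |S - S' j|) (fun j => ?_) ?_
    · refine abs_setIntegral_sub_le ((hGc.comp (hτc j)).aestronglyMeasurable.mul (hzm j))
        (by positivity) ?_ fun s hs => ?_
      · filter_upwards [hzb j] with s hs
        rw [norm_mul]
        exact mul_le_mul (hGb _) hs (norm_nonneg _) hC0
      · have : z j s = 0 := indicator_of_notMem hs _
        rw [this, homogExt_zero, mul_zero]
    · simpa using (((tendsto_const_nhds (x := S)).sub hS).abs).const_mul (C * (‖f‖ * 2))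
  rw [hright]
  simp_rw [hleft]
  have hsum := (hcut.add hdom).add hlim
  rw [zero_add, zero_add] at hsum
  refine hsum.congr fun j => ?_
  have hi1 : IntegrableOn (fun s => (G (τ j s) - G (youngTime ν s)) * homogExt f (z j s))
      (Icc 0 S) := Integrable.of_bound (hdiff j).1 _ (hdiff j).2
  have hi2 : IntegrableOn (fun s => G (youngTime ν s) * homogExt f (z j s)) (Icc 0 S) := by
    refine Integrable.of_bound ((hGτ.aestronglyMeasurable measurableSet_Icc).mul
      (hzm j).restrict) (C * (‖f‖ * 2)) ?_
    filter_upwards [ae_restrict_of_ae (hzb j)] with s hs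
    rw [norm_mul]
    exact mul_le_mul (hGb _) hs (norm_nonneg _) hC0
  have hadd : ∫ s in Icc 0 S, G (τ j s) * homogExt f (z j s) =
      (∫ s in Icc 0 S, (G (τ j s) - G (youngTime ν s)) * homogExt f (z j s)) +
        ∫ s in Icc 0 S, G (youngTime ν s) * homogExt f (z j s) := by
    rw [← integral_add hi1 hi2]
    refine integral_congr_ae (Eventually.of_forall fun s => ?_)
    ring
  rw [hadd]
  ring

end SpaceTime

theorem mainTheorem6 (d : ℕ) (T : ℝ) (hT : 0 < T)
    -- a bounded sequence in `L¹([0, T]; ℝ^d)`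
    (u : ℕ → ℝ → Vec d)
    (hu : ∀ j, IntegrableOn (u j) (Icc 0 T))
    (hbdd : ∃ C : ℝ, ∀ j, ∫ t in Icc 0 T, ‖u j t‖ ≤ C)
    -- its normalized vertical relaxations
    (S' : ℕ → ℝ) (v : ℕ → ℝ → ℝ) (w : ℕ → ℝ → Vec d)
    (hrelax : ∀ j, IsNormalizedRelaxation T (u j) (S' j) (v j) (w j))
    -- the Young measure generated by them on `[0, S]`
    (S : ℝ) (hS : Tendsto S' atTop (𝓝 S))
    (ν : ℝ → Measure (Vec d × ℝ))
    (hν : GeneratesYoung S (fun j => extendPair (S' j) (v j) (w j)) ν) :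
    -- the time is monotone and onto, and its fibres are points or intervals
    MonotoneOn (youngTime ν) (Icc 0 S) ∧
    youngTime ν '' Icc 0 S = Icc 0 T ∧
    (∀ t ∈ Icc 0 T, (∃ s, fibre S ν t = {s}) ∨ ∃ c e, c < e ∧ fibre S ν t = Icc c e) ∧
    -- the integral formulas for `σ` and `μ_t`
    (∀ g : ℝ → ℝ, ContinuousOn g (Icc 0 T) →
      ∫ t in Icc 0 T, g t ∂(dpmSigma S ν) =
        ∫ s in Icc 0 S, rho ν s * g (youngTime ν s)) ∧
    (∀ᵐ t ∂(dpmSigma S ν), ∀ f : C(DirComp d, ℝ),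
      (∀ s, fibre S ν t = {s} →
        ∫ y, f y ∂(dpmMu S ν t) =
          ∫ z, (rho ν s)⁻¹ * f (ratio z) * (z.2 + ‖z.1‖) ∂(ν s)) ∧
      (∀ c e, c < e → fibre S ν t = Icc c e →
        ∫ y, f y ∂(dpmMu S ν t) =
          ⨍ s in Icc c e, (rho ν s)⁻¹ * ∫ z, f (ratio z) * (z.2 + ‖z.1‖) ∂(ν s))) ∧
    -- `u` generates the DiPerna-Majda measure `(σ, μ)`
    GeneratesDiPernaMajda T u (dpmSigma S ν) (dpmMu S ν) := by
  have hK := fun j => (hrelax j).ae_mem_halfSphere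
  have hm := hν.ae_isHalfSphereMeasure hS hK
  have hY := hν.isYoungMeasure
  have hS0 : 0 ≤ S := ge_of_tendsto' hS fun j => (hrelax j).length_nonneg
  obtain rfl : youngTime ν S = T := hν.youngTime_end hS hrelax
  refine ⟨monotoneOn_youngTime hY hm, image_youngTime hS0 hY hm, fun t ht => ?_, fun g hg => ?_,
    ?_, isDiPernaMajda_dpm hS0 hY hm, fun g hg f => ?_⟩
  · obtain ⟨c, e, hce, h⟩ := exists_fibre_eq_Icc hS0 hY hm ht
    rcases hce.eq_or_lt with rfl | hlt
    · exact Or.inl ⟨c, h.trans (Icc_self c)⟩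
    · exact Or.inr ⟨c, e, hlt, h⟩
  · refine integral_dpmSigma hS0 hY hm ?_
    rw [← restrict_dpmSigma hS0 hY hm]
    exact hg.aestronglyMeasurable measurableSet_Icc
  · filter_upwards [ae_dpmSigma_of_ae hS0 hY hm hm] with t ht f
    refine ⟨fun s hs => ?_, fun c e hce h => ?_⟩
    · have hj : t ∉ jumpTimes S ν := not_not.2 (hs ▸ subsingleton_singleton)
      have hgood := ht hj
      rw [hs, csInf_singleton] at hgood
      rw [dpmMu_of_notMem_jumpTimes hj, hs, csInf_singleton, integral_transported hgood]
    · rw [integral_dpmMu_of_fibre_eq_Icc hY hm hce h]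
      refine average_congr ?_
      filter_upwards [ae_restrict_of_ae_restrict_of_subset (h ▸ fibre_subset t) hm] with s hs
      exact integral_transported' hs f
  · rw [integral_dpm hS0 hY hm hg]
    simp_rw [fun j => (hrelax j).integral_eq (hu j) hg f]
    exact hν.tendsto_integral hT.le hS hrelax hg f
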